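/- **Setting.** Let $q\in(\tfrac12,1)$. A ground truth $\theta\in\{0,1\}$ is a fair bit; given $\theta$, the $n$ agents (the vertices of a graph $G$) receive independent private signals $s_v\in\{0,1\}$ with $\mathbb P(s_v=\theta)=q$. The agents act one after the other in a decision order $\sigma$; when $v$ acts it sees $s_v$ and the actions of its earlier neighbours $N_\sigma(v)$ (the neighbours of $v$ in $G$ that precede $v$ in $\sigma$), and it chooses $a_v\in\{0,1\}$. In the *Bayesian model* $v$ knows $G$, $q$ and $\sigma$ and takes the value of $\theta$ that is more probable given what it sees (all agents being Bayesian); in the *majority model* $v$ takes the majority value among $s_v$ and the actions of $N_\sigma(v)$. In both models a tie is broken by following $s_v$. The learning quality is $L_\sigma(G)=\frac1n\sum_v\mathbb P(a_v=\theta)$. For $p:\mathbb N\to[0,1]$, the family $G(n,p(n))$ of Erdős–Rényi graphs *achieves asymptotic random truth learning* if $\mathbb E[L_\sigma(G)]\to1$ as $n\to\infty$, where $G\sim G(n,p(n))$ and $\sigma$ is an independent uniformly random order. **Proposition.** Let $p(n)=\Theta(1)$, that is, $p(n)$ is bounded below by a positive constant for all large $n$. Then under each of the two models the family $G(n,p(n))$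 does not achieve asymptotic random truth learning. Moreover, under each model there is a constant $c>0$ such that for all sufficiently large $n$, with probability at least $c$ (over $G$, $\sigma$, $\theta$ and the signals), the signals of the first two agents are wrong, every later agent has at least two earlier neighbours, and all $n$ agents take the wrong action. -/

import Mathlib

open Filter Topology
open scoped Classical

noncomputable section

namespace SocialLearning

/-- The neighbours of `v` that decide before `v`. The order `σ` sends an agent to its position
(`0` is the first one). -/
def earlierNbrs {n : ℕ} (G : SimpleGraph (Fin n)) (σ : Equiv.Perm (Fin n)) (v : Fin n) :
    Finset (Fin n) :=
  Finset.univ.filter fun u => G.Adj u v ∧ σ u < σ v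

/-- `ℙ(s | θ)` for the vector `s` of all private signals: given the ground truth `θ` the signals
are independent and each is equal to `θ` with probability `q`. -/
def signalProb {n : ℕ} (q : ℝ) (θ : Bool) (s : Fin n → Bool) : ℝ :=
  ∏ v, if s v = θ then q else 1 - q

/-- `ℙ(E)` for an event `E` that depends on the ground truth, a fair bit, and on the signals. -/
def prob {n : ℕ} (q : ℝ) (E : Bool → (Fin n → Bool) → Prop) : ℝ :=
  ∑ θ : Bool, (1 / 2 : ℝ) * ∑ s : Fin n → Bool, if E θ s then signalProb q θ s else 0

/-- The action of `v`, as a function of the vector of all signals, when every agent is Bayesian and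
knows `G`, `q` and `σ`: `v` compares the joint probabilities of the two values of the ground truth
with what it observes, namely its own signal and the actions of its earlier neighbours, and takes
the more probable value. On a tie it follows its own signal. -/
def bayesAction {n : ℕ} (G : SimpleGraph (Fin n)) (q : ℝ) (σ : Equiv.Perm (Fin n))
    (v : Fin n) (s : Fin n → Bool) : Bool :=
  let sameObs : (Fin n → Bool) → Prop := fun s' =>
    s' v = s v ∧ ∀ u, (_ : u ∈ earlierNbrs G σ v) → bayesAction G q σ u s' = bayesAction G q σ u s
  let w : Bool → ℝ := fun c => prob q fun θ s' => θ = c ∧ sameObs s'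
  if w false < w true then true else if w true < w false then false else s v
termination_by (σ v).val
decreasing_by
  all_goals
    have h : u ∈ earlierNbrs G σ v := by assumption
    exact (Finset.mem_filter.mp h).2.2

/-- The action of `v`, as a function of the vector of all signals, when every agent takes the
majority value among the actions of its earlier neighbours and its own signal. On a tie it follows
its own signal. -/
def majorityAction {n : ℕ} (G : SimpleGraph (Fin n)) (σ : Equiv.Perm (Fin n))
    (v : Fin n) (s : Fin n → Bool) : Bool :=
  let votes : Bool → ℕ := fun c =>
    (∑ u : {u // u ∈ earlierNbrs G σ v}, if majorityAction G σ u.1 s = c then 1 else 0) +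
      (if s v = c then 1 else 0)
  if votes false < votes true then true else if votes true < votes false then false else s v
termination_by (σ v).val
decreasing_by
  all_goals exact (Finset.mem_filter.mp u.2).2.2

/-- The two inference models. -/
inductive Model
  | bayesian
  | majority

/-- The action of `v` as a function of the vector of all signals. -/
def action (M : Model) {n : ℕ} (G : SimpleGraph (Fin n)) (q : ℝ) (σ : Equiv.Perm (Fin n))
    (v : Fin n) (s : Fin n → Bool) : Bool :=
  match M with
  | .bayesian => bayesAction G q σ v s
  | .majority => majorityAction G σ v s

/-- `ℓ(v) = ℙ(a_v = θ)`. -/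
def agentQuality (M : Model) {n : ℕ} (G : SimpleGraph (Fin n)) (q : ℝ) (σ : Equiv.Perm (Fin n))
    (v : Fin n) : ℝ :=
  prob q fun θ s => action M G q σ v s = θ

/-- `L_σ(G) = (1 / n) ∑ᵥ ℓ(v)`. -/
def networkQuality (M : Model) {n : ℕ} (G : SimpleGraph (Fin n)) (q : ℝ)
    (σ : Equiv.Perm (Fin n)) : ℝ :=
  (1 / (n : ℝ)) * ∑ v, agentQuality M G q σ v

/-- The expectation of `f G σ` for an Erdős–Rényi graph `G` from `G(n, p)` and an independent,
uniformly random decision order `σ`. -/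
def erAverage (n : ℕ) (p : unitInterval) (f : SimpleGraph (Fin n) → Equiv.Perm (Fin n) → ℝ) : ℝ :=
  ∑ G : SimpleGraph (Fin n), (SimpleGraph.binomialRandom (Fin n) p).real {G} *
    ((1 / (n.factorial : ℝ)) * ∑ σ : Equiv.Perm (Fin n), f G σ)

/-- The family `G(n, p(n))` achieves asymptotic random truth learning: its expected learning
quality under a random decision order tends to `1`. -/
def AchievesRandomTruthLearning (M : Model) (q : ℝ) (p : ℕ → unitInterval) : Prop :=
  Tendsto (fun n => erAverage n (p n) fun G σ => networkQuality M G q σ) atTop (𝓝 1)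

/-- Every agent from the third one on has at least two earlier neighbours. -/
def TwoEarlierNbrs {n : ℕ} (G : SimpleGraph (Fin n)) (σ : Equiv.Perm (Fin n)) : Prop :=
  ∀ v, 2 ≤ (σ v).val → 2 ≤ (earlierNbrs G σ v).card

/-- The probability, over graph, order, ground truth and signals, that the first two agents have
wrong signals, every later agent has at least two earlier neighbours, and all agents take the
wrong action. -/
def herdingProb (M : Model) (q : ℝ) (n : ℕ) (p : unitInterval) : ℝ :=
  erAverage n p fun G σ => prob q fun θ s =>
    (∀ v, (σ v).val < 2 → s v ≠ θ) ∧ TwoEarlierNbrs G σ ∧ ∀ v, action M G q σ v s ≠ θ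

end SocialLearning

end

/-! Two equal wrong signals at the start have probability `(1 - q) ^ 2`. It suffices that, with
probability bounded below over the graph, they force every later agent to copy them. For majority
agents two earlier neighbours are enough, since a unanimous pair outvotes a single signal.

For Bayesian agents, say that an agent reveals its signal when its view leaves the decision to that
signal. The history of actions is determined by the word of revealed signals
(`sameHistory_of_prefix`), so at most as many agents as there are short binary words can be among
the first `h` to reveal, uniformly in `n` and in the graph (`card_nodes_le`). Call them nodes. An
agent that sees all nodes knows the first `h` revealed signals.

Suppose `v` sees such an agent `w` and all its earlier neighbours act `b` (`excess_unanimous_pos`).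
The case that the first two signals are `b` gives a fixed positive evidence for `b`. Otherwise, if
few signals are revealed, then `w` knows the whole history and is itself herding towards `b`, so the
evidence is nonnegative. If many signals are revealed, then `w` errs under truth `!b` only with
exponentially small probability (`condProb_deep_le`), which a large `m` makes negligible. Hence `v`
joins the herd (`bayesAction_eq_of_wellConnected`).

It remains that every later agent sees all earlier nodes or two agents that see them. The graph is
exposed agent by agent. The number of watchers, who see all nodes so far, tends to grow, and the
risk of missing them decays geometrically in it, hence summably; only boundedly many new nodes can
reset the number. The potential `survival` does not decrease on average (`survival_le_average`),
which gives the constant (`exists_wellConnected_bound`). -/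

noncomputable section
namespace SocialLearning

/-! ### Conditional probabilities of signal events -/

variable {n : ℕ}

/-- `ℙ(E | θ)` for an event `E` that depends on the signals. -/
def condProb (q : ℝ) (θ : Bool) (E : (Fin n → Bool) → Prop) : ℝ :=
  ∑ s : Fin n → Bool, if E s then signalProb q θ s else 0

/-- `ℙ(s_v = b | θ)`. -/
def bitProb (q : ℝ) (θ b : Bool) : ℝ := if b = θ then q else 1 - q

theorem bitProb_nonneg {q : ℝ} (h0 : 0 ≤ q) (h1 : q ≤ 1) (θ b : Bool) : 0 ≤ bitProb q θ b := by
  unfold bitProb; split_ifs <;> linarith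

theorem bitProb_add_not (q : ℝ) (θ b : Bool) : bitProb q θ b + bitProb q θ (!b) = 1 := by
  cases θ <;> cases b <;> simp [bitProb]

theorem signalProb_nonneg {q : ℝ} (h0 : 0 ≤ q) (h1 : q ≤ 1) (θ : Bool) (s : Fin n → Bool) :
    0 ≤ signalProb q θ s :=
  Finset.prod_nonneg fun v _ => bitProb_nonneg h0 h1 θ (s v)

theorem condProb_nonneg {q : ℝ} (h0 : 0 ≤ q) (h1 : q ≤ 1) (θ : Bool)
    (E : (Fin n → Bool) → Prop) : 0 ≤ condProb q θ E :=
  Finset.sum_nonneg fun s _ => by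
    split_ifs
    · exact signalProb_nonneg h0 h1 θ s
    · exact le_rfl

theorem condProb_mono {q : ℝ} (h0 : 0 ≤ q) (h1 : q ≤ 1) (θ : Bool)
    {E E' : (Fin n → Bool) → Prop} (h : ∀ s, E s → E' s) : condProb q θ E ≤ condProb q θ E' :=
  Finset.sum_le_sum fun s _ => by
    by_cases hE : E s
    · simp [hE, h s hE]
    · simp only [hE, if_false]
      split_ifs
      · exact signalProb_nonneg h0 h1 θ s
      · exact le_rfl

theorem condProb_congr (q : ℝ) (θ : Bool) {E E' : (Fin n → Bool) → Prop}
    (h : ∀ s, E s ↔ E' s) : condProb q θ E = condProb q θ E' := by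
  have : E = E' := funext fun s => propext (h s)
  rw [this]

theorem condProb_or (q : ℝ) (θ : Bool) {E E' : (Fin n → Bool) → Prop}
    (h : ∀ s, E s → ¬ E' s) :
    condProb q θ (fun s => E s ∨ E' s) = condProb q θ E + condProb q θ E' := by
  unfold condProb
  rw [← Finset.sum_add_distrib]
  refine Finset.sum_congr rfl fun s _ => ?_
  by_cases h1 : E s
  · simp [h1, h s h1]
  · simp [h1]

theorem condProb_le_sum {ι : Type*} [Fintype ι] {q : ℝ} (h0 : 0 ≤ q) (h1 : q ≤ 1) (θ : Bool)
    {E : (Fin n → Bool) → Prop} {F : ι → (Fin n → Bool) → Prop} (h : ∀ s, E s → ∃ i, F i s) :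
    condProb q θ E ≤ ∑ i, condProb q θ (F i) := by
  unfold condProb
  rw [Finset.sum_comm]
  refine Finset.sum_le_sum fun s _ => ?_
  have hnn : ∀ i, 0 ≤ if F i s then signalProb q θ s else 0 := by
    intro i
    split_ifs
    · exact signalProb_nonneg h0 h1 _ s
    · exact le_rfl
  by_cases hs : E s
  · obtain ⟨i, hi⟩ := h s hs
    rw [if_pos hs]
    refine le_trans ?_ (Finset.single_le_sum (fun i _ => hnn i) (Finset.mem_univ i))
    rw [if_pos hi]
  · rw [if_neg hs]
    exact Finset.sum_nonneg fun i _ => hnn i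

theorem condProb_split (q : ℝ) (θ : Bool) (E C : (Fin n → Bool) → Prop) :
    condProb q θ E = condProb q θ (fun s => E s ∧ C s) + condProb q θ (fun s => E s ∧ ¬ C s) := by
  rw [← condProb_or q θ (fun s h h' => h'.2 h.2)]
  exact condProb_congr q θ fun s => by tauto

theorem signalProb_update (q : ℝ) (θ : Bool) (s : Fin n → Bool) (v : Fin n) (b : Bool) :
    bitProb q θ (s v) * signalProb q θ (Function.update s v b) =
      bitProb q θ b * signalProb q θ s := by
  unfold signalProb
  rw [← Finset.mul_prod_erase Finset.univ _ (Finset.mem_univ v),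
    ← Finset.mul_prod_erase Finset.univ (fun v => if s v = θ then q else 1 - q)
      (Finset.mem_univ v)]
  have : ∏ x ∈ Finset.univ.erase v, (if Function.update s v b x = θ then q else 1 - q) =
      ∏ x ∈ Finset.univ.erase v, (if s x = θ then q else 1 - q) :=
    Finset.prod_congr rfl fun x hx => by
      rw [Function.update_of_ne (Finset.ne_of_mem_erase hx)]
  rw [this]
  simp only [Function.update_self, bitProb]
  ring

/-- The signal of `v` is independent of the events that do not depend on it. -/
theorem condProb_and_signal (q : ℝ) (θ : Bool) (v : Fin n) (b : Bool)
    {E : (Fin n → Bool) → Prop} (hE : ∀ s c, E (Function.update s v c) ↔ E s) :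
    condProb q θ (fun s => E s ∧ s v = b) = bitProb q θ b * condProb q θ E := by
  -- Flipping the signal of `v` is an involution that preserves `E`; the cross-multiplied form
  -- avoids dividing by `bitProb`.
  have key : bitProb q θ (!b) * condProb q θ (fun s => E s ∧ s v = b) =
      bitProb q θ b * condProb q θ (fun s => E s ∧ s v = !b) := by
    unfold condProb
    rw [Finset.mul_sum, Finset.mul_sum]
    refine Finset.sum_nbij' (fun s => Function.update s v (!(s v)))
      (fun s => Function.update s v (!(s v))) (by simp) (by simp) (by simp) (by simp) ?_
    intro s _
    by_cases h : E s ∧ s v = b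
    · have h' : E (Function.update s v !s v) ∧ Function.update s v (!s v) v = !b := by
        simp [hE, h.1, h.2]
      rw [if_pos h, if_pos h', ← h.2, signalProb_update]
    · have h' : ¬ (E (Function.update s v !s v) ∧ Function.update s v (!s v) v = !b) := by
        simpa [hE] using h
      rw [if_neg h, if_neg h']
      simp
  have hs := condProb_split q θ E (fun s => s v = b)
  have hn : condProb q θ (fun s => E s ∧ ¬ s v = b) = condProb q θ (fun s => E s ∧ s v = !b) :=
    condProb_congr q θ fun s => by cases s v <;> cases b <;> simp
  have ha := bitProb_add_not q θ b
  rw [hn] at hs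
  rw [hs]
  linear_combination key - condProb q θ (fun s => E s ∧ s v = b) * ha

theorem condProb_true (q : ℝ) (θ : Bool) : condProb q θ (fun _ : Fin n → Bool => True) = 1 := by
  simp only [condProb, if_true, signalProb]
  rw [← Fintype.prod_sum (fun (_ : Fin n) (b : Bool) => if b = θ then q else 1 - q)]
  cases θ <;> simp

theorem prob_eq_condProb (q : ℝ) (E : Bool → (Fin n → Bool) → Prop) :
    prob q E = ∑ θ : Bool, (1 / 2 : ℝ) * condProb q θ (E θ) := rfl

/-- The excess of the joint weight of `E` and truth `b` over that of `E` and truth `!b`, for an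
observer whose own signal is `!b`. -/
def excess (q : ℝ) (b : Bool) (E : (Fin n → Bool) → Prop) : ℝ :=
  (1 - q) * condProb q b E - q * condProb q (!b) E

theorem excess_congr (q : ℝ) (b : Bool) {E E' : (Fin n → Bool) → Prop}
    (h : ∀ s, E s ↔ E' s) : excess q b E = excess q b E' := by
  rw [excess, excess, condProb_congr q b h, condProb_congr q (!b) h]

theorem excess_split (q : ℝ) (b : Bool) (E C : (Fin n → Bool) → Prop) :
    excess q b E = excess q b (fun s => E s ∧ C s) + excess q b (fun s => E s ∧ ¬ C s) := by
  rw [excess, condProb_split q b E C, condProb_split q (!b) E C, excess, excess]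
  ring

/-- An inequality between the weights of an event follows from the inequalities for the classes
of a partition. -/
theorem condProb_le_of_classes {β : Type*} (key : (Fin n → Bool) → β)
    {E : (Fin n → Bool) → Prop} (hE : ∀ s s', key s' = key s → E s → E s') (q α γ : ℝ) (b c : Bool)
    (h : ∀ s, E s → α * condProb q b (fun s' => key s' = key s) ≤
      γ * condProb q c (fun s' => key s' = key s)) :
    α * condProb q b E ≤ γ * condProb q c E := by
  have expand : ∀ θ, condProb q θ E =
      ∑ k ∈ (Finset.univ.filter E).image key, condProb q θ (fun s' => key s' = k) := by
    intro θ
    unfold condProb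
    rw [← Finset.sum_filter, ← Finset.sum_fiberwise_of_maps_to
      (g := key) (t := (Finset.univ.filter E).image key)
      (fun s hs => Finset.mem_image_of_mem key hs)]
    refine Finset.sum_congr rfl fun k hk => ?_
    obtain ⟨s, hs, rfl⟩ := Finset.mem_image.mp hk
    rw [← Finset.sum_filter]
    refine Finset.sum_congr ?_ fun _ _ => rfl
    ext s'
    simp only [Finset.mem_filter, Finset.mem_univ, true_and] at hs ⊢
    exact ⟨fun h => h.2, fun h => ⟨hE s s' h hs, h⟩⟩
  rw [expand, expand, Finset.mul_sum, Finset.mul_sum]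
  refine Finset.sum_le_sum fun k hk => ?_
  obtain ⟨s, hs, rfl⟩ := Finset.mem_image.mp hk
  exact h s (Finset.mem_filter.mp hs).2

end SocialLearning
end

/-! ### Bayesian actions: forced decisions and revealed signals -/

noncomputable section
namespace SocialLearning

variable {n : ℕ} {G : SimpleGraph (Fin n)} {q : ℝ} {σ : Equiv.Perm (Fin n)}

theorem mem_earlierNbrs {u v : Fin n} : u ∈ earlierNbrs G σ v ↔ G.Adj u v ∧ σ u < σ v := by
  simp [earlierNbrs]

/-- The earlier neighbours of `v` act in the same way under `s` and `s'`. -/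
def SameView (G : SimpleGraph (Fin n)) (q : ℝ) (σ : Equiv.Perm (Fin n)) (v : Fin n)
    (s s' : Fin n → Bool) : Prop :=
  ∀ u ∈ earlierNbrs G σ v, bayesAction G q σ u s' = bayesAction G q σ u s

theorem SameView.iff {v : Fin n} {s s' : Fin n → Bool} (h : SameView G q σ v s s')
    (t : Fin n → Bool) : SameView G q σ v s t ↔ SameView G q σ v s' t :=
  forall₂_congr fun u hu => by rw [h u hu]

/-- The joint probability of truth `c`, the signal of `v` and the actions that `v` sees. -/
def viewWeight (G : SimpleGraph (Fin n)) (q : ℝ) (σ : Equiv.Perm (Fin n)) (v : Fin n)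
    (s : Fin n → Bool) (c : Bool) : ℝ :=
  condProb q c fun s' => s' v = s v ∧ SameView G q σ v s s'

theorem bayesAction_eq (v : Fin n) (s : Fin n → Bool) :
    bayesAction G q σ v s =
      if viewWeight G q σ v s false < viewWeight G q σ v s true then true
      else if viewWeight G q σ v s true < viewWeight G q σ v s false then false else s v := by
  have h : ∀ c : Bool, (prob q fun θ s' => θ = c ∧ s' v = s v ∧ ∀ u, (_ : u ∈ earlierNbrs G σ v) →
      bayesAction G q σ u s' = bayesAction G q σ u s) = 1 / 2 * viewWeight G q σ v s c := by
    intro c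
    have : ∀ E : (Fin n → Bool) → Prop, (prob q fun θ s' => θ = c ∧ E s') =
        1 / 2 * condProb q c E := by
      intro E
      rw [prob_eq_condProb]
      cases c <;> simp [condProb]
    exact this _
  rw [bayesAction]
  simp only [h]
  have e : ∀ a b : ℝ, 1 / 2 * a < 1 / 2 * b ↔ a < b := fun a b => by
    constructor <;> intro h <;> linarith
  simp only [e]

theorem bayesAction_congr_view {v : Fin n} {s s' : Fin n → Bool} (h : SameView G q σ v s s')
    (hs : s v = s' v) : bayesAction G q σ v s = bayesAction G q σ v s' := by
  have hw : viewWeight G q σ v s = viewWeight G q σ v s' := by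
    funext c
    exact condProb_congr q c fun t => by rw [hs, h.iff]
  rw [bayesAction_eq, bayesAction_eq, hw, hs]

/-- The action of an agent depends only on the signals of the agents up to it. -/
theorem bayesAction_congr (v : Fin n) {s s' : Fin n → Bool}
    (h : ∀ u, σ u ≤ σ v → s u = s' u) : bayesAction G q σ v s = bayesAction G q σ v s' := by
  refine bayesAction_congr_view (fun u hu => ?_) (h v le_rfl)
  have hlt := (mem_earlierNbrs.mp hu).2
  exact (bayesAction_congr u fun w hw => h w (hw.trans hlt.le)).symm
termination_by (σ v).val
decreasing_by exact hlt

theorem bayesAction_update {u v : Fin n} (huv : σ u < σ v) (s : Fin n → Bool) (c : Bool) :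
    bayesAction G q σ u (Function.update s v c) = bayesAction G q σ u s :=
  bayesAction_congr u fun w hw => Function.update_of_ne (by
    rintro rfl
    exact absurd hw (not_le.mpr huv)) _ _

theorem sameView_update (v : Fin n) (s t : Fin n → Bool) (c : Bool) :
    SameView G q σ v s (Function.update t v c) ↔ SameView G q σ v s t :=
  forall₂_congr fun u hu => by rw [bayesAction_update (mem_earlierNbrs.mp hu).2]

/-- Earlier actions do not depend on the signal of `v`, so the weight factors. -/
theorem viewWeight_eq (v : Fin n) (s : Fin n → Bool) (c : Bool) :
    viewWeight G q σ v s c = bitProb q c (s v) * condProb q c (SameView G q σ v s) := by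
  rw [← condProb_and_signal q c v (s v) (E := SameView G q σ v s)
    fun t d => sameView_update v s t d]
  exact condProb_congr q c fun _ => and_comm

/-- Bayesian agents maximize the posterior probability. -/
theorem viewWeight_not_le {v : Fin n} {s : Fin n → Bool} {b : Bool}
    (h : bayesAction G q σ v s = b) : viewWeight G q σ v s (!b) ≤ viewWeight G q σ v s b := by
  rw [bayesAction_eq] at h
  split_ifs at h with h1 h2
  · subst h; exact h1.le
  · subst h; exact h2.le
  · cases b
    · exact not_lt.mp h1
    · exact not_lt.mp h2

/-- What `v` sees makes it choose `b` whatever its own signal is when this is positive. -/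
def herdExcess (G : SimpleGraph (Fin n)) (q : ℝ) (σ : Equiv.Perm (Fin n)) (b : Bool) (v : Fin n)
    (s : Fin n → Bool) : ℝ :=
  excess q b (SameView G q σ v s)

theorem herdExcess_congr {v : Fin n} {s s' : Fin n → Bool} (h : SameView G q σ v s s') (b : Bool) :
    herdExcess G q σ b v s = herdExcess G q σ b v s' :=
  excess_congr q b h.iff

/-- The excess is computed for the adverse signal `!b`; the signal `b` only helps, because `1 - q <
q`. -/
theorem bayesAction_of_herdExcess_pos (hq : 1 / 2 < q) (hq1 : q < 1) {b : Bool} {v : Fin n}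
    {s : Fin n → Bool} (h : 0 < herdExcess G q σ b v s) : bayesAction G q σ v s = b := by
  have h0 : 0 ≤ condProb q b (SameView G q σ v s) := condProb_nonneg (by linarith) hq1.le _ _
  have h1 : 0 ≤ condProb q (!b) (SameView G q σ v s) := condProb_nonneg (by linarith) hq1.le _ _
  have hlt : viewWeight G q σ v s (!b) < viewWeight G q σ v s b := by
    rw [viewWeight_eq, viewWeight_eq]
    unfold herdExcess excess at h
    by_cases hb : s v = b
    · simp only [bitProb, hb, if_true]
      rw [if_neg (by simp)]
      nlinarith
    · have : s v = !b := by revert hb; cases s v <;> cases b <;> simp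
      simp only [bitProb, this, if_true]
      rw [if_neg (by simp)]
      linarith
  rw [bayesAction_eq]
  cases b <;> simp only [Bool.not_true, Bool.not_false] at hlt
  · rw [if_neg (not_lt.mpr hlt.le), if_pos hlt]
  · rw [if_pos hlt]

/-- What `v` sees leaves its decision to its own signal. -/
def Reveals (G : SimpleGraph (Fin n)) (q : ℝ) (σ : Equiv.Perm (Fin n)) (v : Fin n)
    (s : Fin n → Bool) : Prop :=
  ∀ b, herdExcess G q σ b v s ≤ 0

theorem reveals_congr {v : Fin n} {s s' : Fin n → Bool} (h : SameView G q σ v s s') :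
    Reveals G q σ v s ↔ Reveals G q σ v s' :=
  forall_congr' fun b => by rw [herdExcess_congr h]

/-- The view can at most tie against the agent's own signal, and ties follow that signal. -/
theorem Reveals.bayesAction_eq {v : Fin n} {s : Fin n → Bool} (h : Reveals G q σ v s) :
    bayesAction G q σ v s = s v := by
  have ht := h true
  have hf := h false
  rw [SocialLearning.bayesAction_eq]
  simp only [viewWeight_eq]
  simp only [herdExcess, excess, Bool.not_true, Bool.not_false] at ht hf
  cases hs : s v <;> simp only [bitProb] <;> split_ifs with h1 h2 <;> simp_all <;> linarith

theorem herdExcess_pos_of_not_reveals (hq : 1 / 2 < q) (hq1 : q < 1) {v : Fin n}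
    {s : Fin n → Bool} (h : ¬ Reveals G q σ v s) :
    0 < herdExcess G q σ (bayesAction G q σ v s) v s := by
  simp only [Reveals, not_forall, not_le] at h
  obtain ⟨b, hb⟩ := h
  rwa [bayesAction_of_herdExcess_pos hq hq1 hb]

/-! ### The word of revealed signals and the bounded set of nodes -/

/-- The agents in the first `k` positions act in the same way under `s` and `s'`. -/
def SameHistory (G : SimpleGraph (Fin n)) (q : ℝ) (σ : Equiv.Perm (Fin n)) (k : ℕ)
    (s s' : Fin n → Bool) : Prop :=
  ∀ u, (σ u).val < k → bayesAction G q σ u s' = bayesAction G q σ u s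

theorem SameHistory.sameView {k : ℕ} {s s' : Fin n → Bool} (h : SameHistory G q σ k s s')
    {v : Fin n} (hv : (σ v).val ≤ k) : SameView G q σ v s s' :=
  fun u hu => h u (lt_of_lt_of_le (mem_earlierNbrs.mp hu).2 hv)

/-- At the first position at which two histories differ, the agent reveals its signal. -/
theorem exists_reveals_of_not_sameHistory (hq : 1 / 2 < q) (hq1 : q < 1) {k : ℕ}
    {s s' : Fin n → Bool} (h : ¬ SameHistory G q σ k s s') :
    ∃ v, (σ v).val < k ∧ SameHistory G q σ (σ v).val s s' ∧ Reveals G q σ v s ∧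
      Reveals G q σ v s' ∧ s v ≠ s' v ∧ bayesAction G q σ v s ≠ bayesAction G q σ v s' := by
  induction k with
  | zero => exact absurd (fun u hu => absurd hu (Nat.not_lt_zero _)) h
  | succ k ih =>
    by_cases hk : SameHistory G q σ k s s'
    · simp only [SameHistory, not_forall] at h
      obtain ⟨v, hv, hne⟩ := h
      have hvk : (σ v).val = k := by
        by_contra hc
        exact hne (hk v (by omega))
      have hview : SameView G q σ v s s' := hk.sameView hvk.le
      have hr : Reveals G q σ v s := by
        by_contra hc
        have := herdExcess_pos_of_not_reveals hq hq1 hc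
        rw [herdExcess_congr hview] at this
        exact hne (bayesAction_of_herdExcess_pos hq hq1 this)
      have hr' := (reveals_congr hview).mp hr
      refine ⟨v, hv, hvk ▸ hk, hr, hr', ?_, fun he => hne he.symm⟩
      rw [← hr.bayesAction_eq, ← hr'.bayesAction_eq]
      exact fun he => hne he.symm
    · obtain ⟨v, hv, hrest⟩ := ih hk
      exact ⟨v, by omega, hrest⟩

/-- The signals that are revealed in the first `k` positions, in order. -/
def code (G : SimpleGraph (Fin n)) (q : ℝ) (σ : Equiv.Perm (Fin n)) (s : Fin n → Bool) :
    ℕ → List Bool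
  | 0 => []
  | k + 1 =>
    if h : k < n then
      if Reveals G q σ (σ.symm ⟨k, h⟩) s then code G q σ s k ++ [s (σ.symm ⟨k, h⟩)]
      else code G q σ s k
    else code G q σ s k

theorem code_prefix (s : Fin n → Bool) {j k : ℕ} (h : j ≤ k) :
    code G q σ s j <+: code G q σ s k := by
  induction k, h using Nat.le_induction with
  | base => exact List.prefix_rfl
  | succ k _ ih =>
    refine ih.trans ?_
    rw [code]
    split_ifs
    · exact List.prefix_append _ _
    · exact List.prefix_rfl
    · exact List.prefix_rfl

theorem code_succ_of_reveals {v : Fin n} {s : Fin n → Bool} (h : Reveals G q σ v s) :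
    code G q σ s ((σ v).val + 1) = code G q σ s (σ v).val ++ [s v] := by
  rw [code, dif_pos (σ v).isLt]
  simp [h]

theorem code_succ_of_not_reveals {v : Fin n} {s : Fin n → Bool} (h : ¬ Reveals G q σ v s) :
    code G q σ s ((σ v).val + 1) = code G q σ s (σ v).val := by
  rw [code, dif_pos (σ v).isLt]
  simp [h]

theorem code_length_lt {v : Fin n} {s : Fin n → Bool} (h : Reveals G q σ v s) {k : ℕ}
    (hk : (σ v).val < k) : (code G q σ s (σ v).val).length < (code G q σ s k).length := by
  have := (code_prefix (G := G) (q := q) (σ := σ) s (Nat.succ_le_of_lt hk)).length_le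
  rw [Nat.succ_eq_add_one, code_succ_of_reveals h] at this
  simp at this
  omega

theorem code_congr {k : ℕ} {s s' : Fin n → Bool}
    (h : SameHistory G q σ k s s') : code G q σ s k = code G q σ s' k := by
  induction k with
  | zero => rfl
  | succ k ih =>
    have hk : SameHistory G q σ k s s' := fun u hu => h u (by omega)
    rw [code, code, ih hk]
    split_ifs with hn h1 h2 h2
    · have := h (σ.symm ⟨k, hn⟩) (by simp)
      rw [h1.bayesAction_eq, h2.bayesAction_eq] at this
      rw [this]
    · exact absurd ((reveals_congr (hk.sameView (by simp))).mp h1) h2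
    · exact absurd ((reveals_congr (hk.sameView (by simp))).mpr h2) h1
    · rfl
    · rfl

/-- The codes of two different histories are not prefixes of a common list. -/
theorem sameHistory_of_prefix (hq : 1 / 2 < q) (hq1 : q < 1) {k : ℕ} {s s' : Fin n → Bool}
    {l : List Bool} (h : code G q σ s k <+: l) (h' : code G q σ s' k <+: l) :
    SameHistory G q σ k s s' := by
  by_contra hc
  obtain ⟨v, hv, hh, hr, hr', hne, -⟩ := exists_reveals_of_not_sameHistory hq hq1 hc
  have e := (code_prefix (G := G) (q := q) (σ := σ) s (Nat.succ_le_of_lt hv)).trans h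
  have e' := (code_prefix (G := G) (q := q) (σ := σ) s' (Nat.succ_le_of_lt hv)).trans h'
  rw [Nat.succ_eq_add_one, code_succ_of_reveals hr] at e
  rw [Nat.succ_eq_add_one, code_succ_of_reveals hr', ← code_congr hh] at e'
  have := List.prefix_of_prefix_length_le e e' (by simp)
  simp at this
  exact hne this

/-- The agents that can be among the first `h` agents to reveal their signals. -/
def nodes (G : SimpleGraph (Fin n)) (q : ℝ) (σ : Equiv.Perm (Fin n)) (h : ℕ) : Finset (Fin n) :=
  Finset.univ.filter fun v => ∃ s, Reveals G q σ v s ∧ (code G q σ s (σ v).val).length < h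

theorem mem_nodes {h : ℕ} {v : Fin n} : v ∈ nodes G q σ h ↔
    ∃ s, Reveals G q σ v s ∧ (code G q σ s (σ v).val).length < h := by
  simp [nodes]

/-- Send each node to the word revealed before it on a witnessing signal vector. Equal words at two
nodes would give equal histories up to the earlier one, which then reveals on both vectors and makes
the later word strictly longer. So the map into short words is injective. -/
theorem card_nodes_le (hq : 1 / 2 < q) (hq1 : q < 1) (h : ℕ) :
    (nodes G q σ h).card ≤ (List.finite_length_lt Bool h).toFinset.card := by
  have hex : ∀ v : Fin n, ∃ s : Fin n → Bool, v ∈ nodes G q σ h →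
      Reveals G q σ v s ∧ (code G q σ s (σ v).val).length < h := by
    intro v
    by_cases hv : v ∈ nodes G q σ h
    · obtain ⟨s, hs⟩ := mem_nodes.mp hv
      exact ⟨s, fun _ => hs⟩
    · exact ⟨fun _ => true, fun h => absurd h hv⟩
  choose S hS using hex
  refine Finset.card_le_card_of_injOn (fun v => code G q σ (S v) (σ v).val) ?_ ?_
  · intro v hv
    simpa using (hS v hv).2
  · have key : ∀ u ∈ nodes G q σ h, ∀ v ∈ nodes G q σ h, σ u < σ v →
        code G q σ (S u) (σ u).val ≠ code G q σ (S v) (σ v).val := by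
      intro u hu v hv huv he
      have huv' : (σ u).val < (σ v).val := huv
      have hh : SameHistory G q σ (σ u).val (S u) (S v) :=
        sameHistory_of_prefix hq hq1 List.prefix_rfl (he ▸ code_prefix (S v) huv'.le)
      have hr := (reveals_congr (hh.sameView le_rfl)).mp (hS u hu).1
      have := code_length_lt hr huv'
      rw [← he, code_congr hh] at this
      exact lt_irrefl _ this
    intro u hu v hv he
    by_contra hne
    rcases lt_or_gt_of_ne (fun h => hne (σ.injective h)) with h1 | h1
    · exact key u hu v hv h1 he
    · exact key v hv u hu h1 he.symm

end SocialLearning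
end

/-! ### Rare errors after many revealed signals -/

noncomputable section
namespace SocialLearning

variable {n : ℕ} {G : SimpleGraph (Fin n)} {q : ℝ} {σ : Equiv.Perm (Fin n)}

theorem code_update (s : Fin n → Bool) (v : Fin n) (c : Bool) {k : ℕ} (hk : k ≤ (σ v).val) :
    code G q σ (Function.update s v c) k = code G q σ s k :=
  code_congr fun _ hu => (bayesAction_update (Fin.lt_def.mpr (lt_of_lt_of_le hu hk)) s c).symm

/-- The probability that the code starts with `l`, followed by `a`. -/
theorem condProb_append_prefix_code (θ : Bool) (l : List Bool) (a : Bool) (k : ℕ) :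
    condProb q θ (fun s => l ++ [a] <+: code G q σ s k) =
      bitProb q θ a *
        condProb q θ (fun s => l <+: code G q σ s k ∧ l.length < (code G q σ s k).length) := by
  induction k with
  | zero => simp [code, condProb]
  | succ k ih =>
    by_cases hk : k < n
    · set v := σ.symm ⟨k, hk⟩ with hv
      have hvk : (σ v).val = k := by simp [hv]
      set E : (Fin n → Bool) → Prop := fun s => code G q σ s k = l ∧ Reveals G q σ v s with hE
      -- The letter `a` is either already written or written by `v`; in the second case `E` depends
      -- only on signals before `v`, so the new letter is independent of it.
      have h1 : ∀ s, l ++ [a] <+: code G q σ s (k + 1) ↔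
          l ++ [a] <+: code G q σ s k ∨ (E s ∧ s v = a) := by
        intro s
        by_cases hr : Reveals G q σ v s
        · have := code_succ_of_reveals hr
          rw [hvk] at this
          rw [this, List.prefix_concat_iff]
          simp only [hE, hr, and_true]
          rw [← List.concat_eq_append, ← List.concat_eq_append, List.concat_inj, or_comm,
            eq_comm (a := l), eq_comm (a := a)]
        · have := code_succ_of_not_reveals hr
          rw [hvk] at this
          simp only [this, hE, hr, and_false, false_and, or_false]
      have h2 : ∀ s, (l <+: code G q σ s (k + 1) ∧ l.length < (code G q σ s (k + 1)).length) ↔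
          (l <+: code G q σ s k ∧ l.length < (code G q σ s k).length) ∨ E s := by
        intro s
        by_cases hr : Reveals G q σ v s
        · have := code_succ_of_reveals hr
          rw [hvk] at this
          rw [this, List.prefix_concat_iff]
          simp only [hE, hr, and_true]
          constructor
          · rintro ⟨rfl | h, hl⟩
            · simp at hl
            · rcases h.length_le.lt_or_eq with h' | h'
              · exact Or.inl ⟨h, h'⟩
              · exact Or.inr (h.eq_of_length h').symm
          · rintro (⟨h, h'⟩ | h)
            · exact ⟨Or.inr h, by simp; omega⟩
            · subst h
              exact ⟨Or.inr List.prefix_rfl, by simp⟩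
        · have := code_succ_of_not_reveals hr
          rw [hvk] at this
          simp only [this, hE, hr, and_false, or_false]
      rw [condProb_congr q θ h1, condProb_congr q θ h2, condProb_or, condProb_or, ih,
        condProb_and_signal q θ v a, mul_add]
      · intro s c
        simp only [hE]
        rw [code_update s v c hvk.ge, reveals_congr]
        exact fun u hu => (bayesAction_update (mem_earlierNbrs.mp hu).2 s c).symm
      · rintro s ⟨_, h⟩ ⟨rfl, _⟩
        exact lt_irrefl _ h
      · rintro s h ⟨⟨rfl, _⟩, _⟩
        have := h.length_le
        simp at this
    · have : ∀ s, code G q σ s (k + 1) = code G q σ s k := fun s => by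
        rw [code, dif_neg hk]
      simp only [this, ih]

/-- Each letter is a fresh signal, independent of the past that lets it be revealed. Only an
inequality holds, because the code may stop before it is as long as `l`. -/
theorem condProb_prefix_code_le (h0 : 0 ≤ q) (h1 : q ≤ 1) (θ : Bool) (k : ℕ) (l : List Bool) :
    condProb q θ (fun s => l <+: code G q σ s k) ≤ (l.map (bitProb q θ)).prod := by
  induction l using List.reverseRecOn with
  | nil => simp [condProb_true]
  | append_singleton l a ih =>
    rw [condProb_append_prefix_code, List.map_append, List.prod_append, mul_comm]
    simp only [List.map_cons, List.map_nil, List.prod_cons, List.prod_nil, mul_one]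
    refine mul_le_mul_of_nonneg_right (le_trans ?_ ih) (bitProb_nonneg h0 h1 θ a)
    exact condProb_mono h0 h1 θ fun s h => h.1

theorem prod_bitProb_mul_prod_bitProb (q : ℝ) (b : Bool) (l : List Bool) :
    (l.map (bitProb q b)).prod * (l.map (bitProb q !b)).prod = (q * (1 - q)) ^ l.length := by
  induction l with
  | nil => simp
  | cons a l ih =>
    have : bitProb q b a * bitProb q (!b) a = q * (1 - q) := by
      cases a <;> cases b <;> simp [bitProb, mul_comm]
    simp only [List.map_cons, List.prod_cons, List.length_cons, pow_succ]
    linear_combination ih * (bitProb q b a * bitProb q (!b) a) + (q * (1 - q)) ^ l.length * this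

/-- Events on which at least `2 * m` signals are revealed and which are at least as likely under
truth `b` as under truth `!b` on each initial piece of the code have a small probability
under truth `!b`. -/
theorem condProb_deep_le (h0 : 0 ≤ q) (h1 : q ≤ 1) (b : Bool) (k m : ℕ)
    (E : (Fin n → Bool) → Prop)
    (hE : ∀ l : List Bool,
      condProb q (!b) (fun s => E s ∧ (code G q σ s k).take (2 * m) = l) ≤
      condProb q b (fun s => E s ∧ (code G q σ s k).take (2 * m) = l)) :
    condProb q (!b) (fun s => E s ∧ 2 * m ≤ (code G q σ s k).length) ≤
      (4 * (q * (1 - q))) ^ m := by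
  have hqq : 0 ≤ q * (1 - q) := mul_nonneg h0 (by linarith)
  have hsum : condProb q (!b) (fun s => E s ∧ 2 * m ≤ (code G q σ s k).length) ≤
      ∑ l : List.Vector Bool (2 * m),
        condProb q (!b) (fun s => E s ∧ (code G q σ s k).take (2 * m) = l.toList) := by
    refine condProb_le_sum h0 h1 _ fun s hs => ?_
    exact ⟨⟨(code G q σ s k).take (2 * m), by simp [hs.2]⟩, hs.1, rfl⟩
  refine hsum.trans ?_
  have hterm : ∀ l : List.Vector Bool (2 * m),
      condProb q (!b) (fun s => E s ∧ (code G q σ s k).take (2 * m) = l.toList) ≤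
        (q * (1 - q)) ^ m := by
    intro l
    set x := condProb q (!b) (fun s => E s ∧ (code G q σ s k).take (2 * m) = l.toList)
    have hx0 : 0 ≤ x := condProb_nonneg h0 h1 _ _
    have hle : ∀ θ, condProb q θ (fun s => E s ∧ (code G q σ s k).take (2 * m) = l.toList) ≤
        (l.toList.map (bitProb q θ)).prod := fun θ =>
      (condProb_mono h0 h1 θ fun s hs => hs.2 ▸ List.take_prefix _ _).trans
        (condProb_prefix_code_le (G := G) (σ := σ) h0 h1 θ k _)
    have h2 := (hE l.toList).trans (hle b)
    -- Bounding `x` by the word's weight under either truth bounds `x ^ 2` by a product that depends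
    -- only on the length of the word; summing over the `4 ^ m` words then gives the claim.
    have hp := mul_le_mul h2 (hle !b) hx0 (hx0.trans h2)
    rw [prod_bitProb_mul_prod_bitProb, List.Vector.toList_length, pow_mul'] at hp
    exact (pow_le_pow_iff_left₀ hx0 (pow_nonneg hqq m) two_ne_zero).mp ((sq x).trans_le hp)
  refine (Finset.sum_le_sum fun l _ => hterm l).trans ?_
  rw [Finset.sum_const, Finset.card_univ, card_vector, Fintype.card_bool, nsmul_eq_mul, pow_mul,
    mul_pow]
  norm_num [mul_pow]

theorem condProb_two_signals (q : ℝ) (θ b : Bool) {x y : Fin n} (h : x ≠ y) :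
    condProb q θ (fun s => s x = b ∧ s y = b) = bitProb q θ b * bitProb q θ b := by
  rw [condProb_and_signal q θ y b (E := fun s => s x = b)
    (fun s c => by rw [Function.update_of_ne h])]
  have := condProb_and_signal q θ x b (E := fun _ => True) (fun s c => Iff.rfl)
  rw [condProb_true, mul_one] at this
  rw [← this]
  simp

/-- The excess of the event that two given agents have signal `b`. -/
theorem excess_two_signals (q : ℝ) (b : Bool) {x y : Fin n} (h : x ≠ y) :
    excess q b (fun s => s x = b ∧ s y = b) = q * (1 - q) * (2 * q - 1) := by
  rw [excess, condProb_two_signals q b b h, condProb_two_signals q (!b) b h]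
  cases b <;> simp [bitProb] <;> ring

/-- At most one signal is visible, and it can at best tie with the agent's own. -/
theorem reveals_of_pos_lt_two (hq : 1 / 2 < q) {v : Fin n} (hv : (σ v).val < 2)
    (s : Fin n → Bool) : Reveals G q σ v s := by
  intro b
  rw [herdExcess, excess]
  rcases (earlierNbrs G σ v).eq_empty_or_nonempty with he | ⟨u, hu⟩
  · have : ∀ θ, condProb q θ (SameView G q σ v s) = 1 := fun θ => by
      rw [← condProb_true (n := n) q θ]
      exact condProb_congr q θ fun t => by simp [SameView, he]
    rw [this, this]
    linarith
  · have huv : (σ u).val < (σ v).val := (mem_earlierNbrs.mp hu).2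
    have hact : ∀ t, bayesAction G q σ u t = t u := by
      intro t
      refine Reveals.bayesAction_eq fun c => ?_
      have hview : ∀ θ, condProb q θ (SameView G q σ u t) = 1 := fun θ => by
        rw [← condProb_true (n := n) q θ]
        refine condProb_congr q θ fun t' => iff_true_intro fun w hw => ?_
        have : (σ w).val < (σ u).val := (mem_earlierNbrs.mp hw).2
        omega
      rw [herdExcess, excess, hview, hview]
      linarith
    have : ∀ θ, condProb q θ (SameView G q σ v s) = bitProb q θ (s u) := fun θ => by
      have h1 := condProb_and_signal q θ u (s u) (E := fun _ : Fin n → Bool => True)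
        fun _ _ => Iff.rfl
      rw [condProb_true, mul_one] at h1
      rw [← h1]
      refine condProb_congr q θ fun t => ?_
      simp only [true_and]
      constructor
      · intro h
        rw [← hact t, ← hact s]
        exact h u hu
      · intro h w hw
        have hwv : (σ w).val < (σ v).val := (mem_earlierNbrs.mp hw).2
        have : w = u := σ.injective (Fin.ext (by omega))
        rw [this, hact, hact, h]
    rw [this, this]
    cases b <;> cases s u <;> simp [bitProb] <;> nlinarith

theorem mem_nodes_of_pos_lt_two (hq : 1 / 2 < q) {h : ℕ} (hh : 2 ≤ h) {v : Fin n}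
    (hv : (σ v).val < 2) : v ∈ nodes G q σ h := by
  refine mem_nodes.mpr ⟨fun _ => true, reveals_of_pos_lt_two hq hv _, lt_of_lt_of_le ?_ hh⟩
  have : ∀ k, (code G q σ (fun _ => true) k).length ≤ k := by
    intro k
    induction k with
    | zero => simp [code]
    | succ k ih =>
      rw [code]
      split_ifs
      · simpa using ih
      · omega
      · omega
  exact (this _).trans_lt hv

/-- Whoever sees the actions of all nodes before position `k` knows the start of the code. -/
theorem take_code_eq (hq : 1 / 2 < q) (hq1 : q < 1) {h k : ℕ} {s s' : Fin n → Bool}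
    (hs : ∀ u ∈ nodes G q σ h, (σ u).val < k → bayesAction G q σ u s' = bayesAction G q σ u s) :
    (code G q σ s k).take h = (code G q σ s' k).take h ∧
      ((code G q σ s k).length < h → SameHistory G q σ k s s') := by
  by_cases hh : SameHistory G q σ k s s'
  · exact ⟨by rw [code_congr hh], fun _ => hh⟩
  obtain ⟨v, hv, hv', hr, hr', -, hne⟩ := exists_reveals_of_not_sameHistory hq hq1 hh
  -- If the common word at the first disagreement `v` were shorter than `h`, then `v` would be a
  -- node, whose actions agree by assumption.
  have hl : h ≤ (code G q σ s (σ v).val).length := by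
    by_contra hc
    exact hne (hs v (mem_nodes.mpr ⟨s, hr, not_le.mp hc⟩) hv).symm
  have hp := code_prefix (G := G) (q := q) (σ := σ) s hv.le
  have hp' := code_prefix (G := G) (q := q) (σ := σ) s' hv.le
  rw [← code_congr hv'] at hp'
  refine ⟨?_, fun hc => absurd hp.length_le (by omega)⟩
  obtain ⟨l, e⟩ := hp
  obtain ⟨l', e'⟩ := hp'
  rw [← e, ← e', List.take_append_of_le_length hl, List.take_append_of_le_length hl]

/-! ### The herding induction for Bayesian agents -/

/-- If an earlier neighbour of `v` sees all earlier nodes, then unanimous earlier neighbours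
outweigh the signal of `v`. -/
theorem excess_unanimous_pos (hq : 1 / 2 < q) (hq1 : q < 1) {m : ℕ}
    (hm : (4 * (q * (1 - q))) ^ m < (1 - q) * (2 * q - 1)) {v w x y : Fin n} {b : Bool}
    (hw : w ∈ earlierNbrs G σ v)
    (hsub : ∀ u ∈ nodes G q σ (2 * m), σ u < σ v → u ∈ earlierNbrs G σ w)
    (hxy : x ≠ y) (hx : σ x < σ v) (hy : σ y < σ v)
    (hxa : ∀ s, bayesAction G q σ x s = s x) (hya : ∀ s, bayesAction G q σ y s = s y)
    (hconf : ∀ s, s x = b → s y = b → ∀ u, σ u < σ v → bayesAction G q σ u s = b) :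
    0 < excess q b fun s => ∀ u ∈ earlierNbrs G σ v, bayesAction G q σ u s = b := by
  have h0 : 0 ≤ q := by linarith
  have hwv := (mem_earlierNbrs.mp hw).2
  set A : (Fin n → Bool) → Prop := fun s => ∀ u ∈ earlierNbrs G σ v, bayesAction G q σ u s = b
    with hA
  set B : (Fin n → Bool) → Prop := fun s => s x = b ∧ s y = b with hB
  set D : (Fin n → Bool) → Prop := fun s => 2 * m ≤ (code G q σ s (σ v).val).length with hD
  -- By `hconf` the event `B` implies `A`, so this part is the evidence of two independent signals.
  have hAB : excess q b (fun s => A s ∧ B s) = q * (1 - q) * (2 * q - 1) := by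
    rw [← excess_two_signals q b hxy]
    exact excess_congr q b fun s => ⟨fun h => h.2, fun h =>
      ⟨fun u hu => hconf s h.1 h.2 u (mem_earlierNbrs.mp hu).2, h⟩⟩
  have hview : ∀ {s s'}, SameView G q σ w s s' → ∀ u ∈ nodes G q σ (2 * m),
      (σ u).val < (σ v).val → bayesAction G q σ u s' = bayesAction G q σ u s :=
    fun hs u hu huv => hs u (hsub u hu huv)
  -- On each class of equal histories, the view of `w` is the entire history before `v`, so the
  -- excess of the class is the `herdExcess` of `w`.
  have hshallow : 0 ≤ excess q b (fun s => (A s ∧ ¬ B s) ∧ ¬ D s) := by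
    rw [excess, sub_nonneg]
    have hkey : ∀ s s' : Fin n → Bool,
        (fun u => if σ u < σ v then bayesAction G q σ u s' else false) =
          (fun u => if σ u < σ v then bayesAction G q σ u s else false) ↔
        SameHistory G q σ (σ v).val s s' := by
      intro s s'
      rw [funext_iff]
      refine forall_congr' fun u => ?_
      by_cases hu : σ u < σ v
      · simp [hu, Fin.lt_def.mp hu]
      · simp [hu]
    refine condProb_le_of_classes
      (fun s u => if σ u < σ v then bayesAction G q σ u s else false) ?_ _ _ _ _ _ ?_
    · rintro s s' he ⟨⟨hAs, hBs⟩, hDs⟩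
      rw [hkey] at he
      refine ⟨⟨fun u hu => (he u (mem_earlierNbrs.mp hu).2).trans (hAs u hu), ?_⟩, ?_⟩
      · intro hBs'
        apply hBs
        have e1 := he x hx
        have e2 := he y hy
        rw [hxa, hxa] at e1
        rw [hya, hya] at e2
        exact ⟨e1 ▸ hBs'.1, e2 ▸ hBs'.2⟩
      · simp only [hD, ← code_congr he]
        exact hDs
    · rintro s ⟨⟨hAs, -⟩, hDs⟩
      have hDs' := not_le.mp hDs
      have hcls : ∀ s', (fun u => if σ u < σ v then bayesAction G q σ u s' else false) =
          (fun u => if σ u < σ v then bayesAction G q σ u s else false) ↔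
          SameView G q σ w s s' := by
        intro s'
        rw [hkey]
        exact ⟨fun h => h.sameView (le_of_lt hwv),
          fun h => (take_code_eq hq hq1 (hview h)).2 hDs'⟩
      -- If `w` revealed here it would be a node before `v`, and `hsub` would make it its own
      -- earlier neighbour.
      have hnr : ¬ Reveals G q σ w s := by
        intro hr
        have := hsub w (mem_nodes.mpr ⟨s, hr, (code_length_lt hr hwv).trans hDs'⟩) hwv
        exact lt_irrefl _ (mem_earlierNbrs.mp this).2
      have hpos := herdExcess_pos_of_not_reveals hq hq1 hnr
      rw [hAs w hw, herdExcess, excess] at hpos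
      rw [condProb_congr q b hcls, condProb_congr q (!b) hcls]
      linarith
  -- Enlarge to the event that `w` acts `b`. Together with the start of the code this is determined
  -- by what `w` observes, so the optimality of `w` compares the two truths on every class.
  have hdeep : condProb q (!b) (fun s => (A s ∧ ¬ B s) ∧ D s) ≤ (4 * (q * (1 - q))) ^ m := by
    refine le_trans (condProb_mono (E' := fun s => bayesAction G q σ w s = b ∧ D s) h0 hq1.le _
      fun s hs => ⟨hs.1.1 w hw, hs.2⟩) ?_
    refine condProb_deep_le h0 hq1.le b _ m _ fun l => ?_
    have hkey : ∀ s s' : Fin n → Bool,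
        (s' w, fun u => if u ∈ earlierNbrs G σ w then bayesAction G q σ u s' else false) =
          (s w, fun u => if u ∈ earlierNbrs G σ w then bayesAction G q σ u s else false) ↔
        s' w = s w ∧ SameView G q σ w s s' := by
      intro s s'
      rw [Prod.mk.injEq, funext_iff]
      refine and_congr_right fun _ => forall_congr' fun u => ?_
      by_cases hu : u ∈ earlierNbrs G σ w <;> simp [hu]
    rw [← one_mul (condProb q (!b) _), ← one_mul (condProb q b _)]
    refine condProb_le_of_classes (fun s =>
      (s w, fun u => if u ∈ earlierNbrs G σ w then bayesAction G q σ u s else false)) ?_ _ _ _ _ _ ?_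
    · rintro s s' he ⟨hs, hl⟩
      obtain ⟨he1, he2⟩ := (hkey s s').mp he
      exact ⟨(bayesAction_congr_view he2 he1.symm) ▸ hs,
        (take_code_eq hq hq1 (hview he2)).1 ▸ hl⟩
    · rintro s ⟨hs, -⟩
      rw [condProb_congr q b (hkey s), condProb_congr q (!b) (hkey s), one_mul, one_mul]
      exact viewWeight_not_le hs
  have hnn : 0 ≤ condProb q b (fun s => (A s ∧ ¬ B s) ∧ D s) := condProb_nonneg h0 hq1.le _ _
  rw [excess_split q b A B, hAB, excess_split q b (fun s => A s ∧ ¬ B s) D,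
    excess.eq_1 q b (fun s => (A s ∧ ¬ B s) ∧ D s)]
  -- The excess is at least `q * (1 - q) * (2 * q - 1) - q * (4 * (q * (1 - q))) ^ m`, which `hm`
  -- makes positive.
  nlinarith

/-- Every agent from the third one on sees all earlier nodes, or has two earlier neighbours that
do. -/
def WellConnected {n : ℕ} (σ : Equiv.Perm (Fin n)) (nd : SimpleGraph (Fin n) → Finset (Fin n))
    (G : SimpleGraph (Fin n)) (v : Fin n) : Prop :=
  (∀ u ∈ nd G, σ u < σ v → u ∈ earlierNbrs G σ v) ∨
    ∃ w ∈ earlierNbrs G σ v, ∃ w' ∈ earlierNbrs G σ v, w ≠ w' ∧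
      (∀ u ∈ nd G, σ u < σ v → u ∈ earlierNbrs G σ w) ∧
      (∀ u ∈ nd G, σ u < σ v → u ∈ earlierNbrs G σ w')

/-- Two agents in the first two positions with the same signal start a herd. -/
theorem bayesAction_eq_of_wellConnected (hq : 1 / 2 < q) (hq1 : q < 1) {m : ℕ} (hm1 : 1 ≤ m)
    (hm : (4 * (q * (1 - q))) ^ m < (1 - q) * (2 * q - 1))
    (hG : ∀ v, 2 ≤ (σ v).val → WellConnected σ (fun G => nodes G q σ (2 * m)) G v)
    {b : Bool} {s : Fin n → Bool} (hs : ∀ v, (σ v).val < 2 → s v = b) (v : Fin n) :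
    bayesAction G q σ v s = b := by
  -- The induction runs over all signal vectors: `v` weighs every vector compatible with its view,
  -- not only the actual one.
  suffices H : ∀ k, ∀ s : Fin n → Bool, (∀ v, (σ v).val < 2 → s v = b) →
      ∀ v, (σ v).val < k → bayesAction G q σ v s = b from H n s hs v (σ v).isLt
  intro k
  induction k with
  | zero => exact fun _ _ _ h => absurd h (Nat.not_lt_zero _)
  | succ k ih =>
    intro s hs v hv
    by_cases h2 : (σ v).val < 2
    · rw [(reveals_of_pos_lt_two hq h2 s).bayesAction_eq, hs v h2]
    have hn : 2 < n := by have := (σ v).isLt; omega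
    set x := σ.symm ⟨0, by omega⟩ with hx
    set y := σ.symm ⟨1, by omega⟩ with hy
    have hsx : (σ x).val = 0 := by simp [hx]
    have hsy : (σ y).val = 1 := by simp [hy]
    have hxy : x ≠ y := fun h => by rw [h] at hsx; omega
    have hfirst : ∀ s : Fin n → Bool, s x = b → s y = b → ∀ v, (σ v).val < 2 → s v = b := by
      intro s h1 h2 u hu
      rcases Nat.lt_succ_iff_lt_or_eq.mp hu with h | h
      · have : u = x := σ.injective (Fin.ext (by omega))
        rw [this, h1]
      · have : u = y := σ.injective (Fin.ext (by omega))
        rw [this, h2]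
    have hxv : σ x < σ v := by rw [Fin.lt_def]; omega
    have hyv : σ y < σ v := by rw [Fin.lt_def]; omega
    have hxa : ∀ s, bayesAction G q σ x s = s x :=
      fun s => (reveals_of_pos_lt_two hq (by omega) s).bayesAction_eq
    have hya : ∀ s, bayesAction G q σ y s = s y :=
      fun s => (reveals_of_pos_lt_two hq (by omega) s).bayesAction_eq
    have hconf : ∀ s, s x = b → s y = b → ∀ u, σ u < σ v → bayesAction G q σ u s = b :=
      fun s h1 h2 u hu => ih s (hfirst s h1 h2) u (by rw [Fin.lt_def] at hu; omega)
    have hpos : 0 < excess q b fun s => ∀ u ∈ earlierNbrs G σ v, bayesAction G q σ u s = b := by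
      -- If `v` sees all earlier nodes, it sees the first two agents, and unanimity is the same
      -- event as both their signals being `b`.
      rcases hG v (by omega) with h | ⟨w, hw, -, -, -, h, -⟩
      · have hnx : x ∈ earlierNbrs G σ v :=
          h x (mem_nodes_of_pos_lt_two hq (by omega) (by omega)) hxv
        have hny : y ∈ earlierNbrs G σ v :=
          h y (mem_nodes_of_pos_lt_two hq (by omega) (by omega)) hyv
        rw [excess_congr q b (E' := fun s => s x = b ∧ s y = b), excess_two_signals q b hxy]
        · have : 0 < 1 - q := by linarith
          have : 0 < 2 * q - 1 := by linarith
          positivity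
        · intro s
          refine ⟨fun h => ⟨hxa s ▸ h x hnx, hya s ▸ h y hny⟩, fun h u hu => ?_⟩
          exact hconf s h.1 h.2 u (mem_earlierNbrs.mp hu).2
      · exact excess_unanimous_pos hq hq1 hm hw h hxy hxv hyv hxa hya hconf
    apply bayesAction_of_herdExcess_pos hq hq1
    rw [herdExcess, excess_congr q b (E' := fun s => ∀ u ∈ earlierNbrs G σ v,
      bayesAction G q σ u s = b)]
    · exact hpos
    · intro s'
      refine forall₂_congr fun u hu => ?_
      rw [hconf s (hs x (by omega)) (hs y (by omega)) u (mem_earlierNbrs.mp hu).2]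

end SocialLearning
end

/-! ### Random subsets, the random graph as a random edge set, and the discount -/

noncomputable section
namespace SocialLearning

/-- The average of `g` over the random subset of `D` that contains each element independently with
probability `p`. -/
def subsetAverage {α : Type*} (p : ℝ) (D : Finset α) (g : Finset α → ℝ) : ℝ :=
  ∑ S ∈ D.powerset, p ^ S.card * (1 - p) ^ (D.card - S.card) * g S

section subsetAverage

variable {α β : Type*} {p : ℝ}

theorem subsetAverage_empty (g : Finset α → ℝ) : subsetAverage p ∅ g = g ∅ := by
  simp [subsetAverage]

theorem subsetAverage_mono (h0 : 0 ≤ p) (h1 : p ≤ 1) {D : Finset α} {f g : Finset α → ℝ}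
    (h : ∀ S ⊆ D, f S ≤ g S) : subsetAverage p D f ≤ subsetAverage p D g :=
  Finset.sum_le_sum fun S hS => mul_le_mul_of_nonneg_left (h S (Finset.mem_powerset.mp hS))
    (mul_nonneg (pow_nonneg h0 _) (pow_nonneg (by linarith) _))

theorem subsetAverage_congr {D : Finset α} {f g : Finset α → ℝ} (h : ∀ S ⊆ D, f S = g S) :
    subsetAverage p D f = subsetAverage p D g :=
  Finset.sum_congr rfl fun S hS => by rw [h S (Finset.mem_powerset.mp hS)]

theorem subsetAverage_add (D : Finset α) (f g : Finset α → ℝ) :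
    subsetAverage p D (fun S => f S + g S) = subsetAverage p D f + subsetAverage p D g := by
  simp only [subsetAverage, mul_add, Finset.sum_add_distrib]

theorem subsetAverage_const_mul (D : Finset α) (a : ℝ) (g : Finset α → ℝ) :
    subsetAverage p D (fun S => a * g S) = a * subsetAverage p D g := by
  rw [subsetAverage, subsetAverage, Finset.mul_sum]
  exact Finset.sum_congr rfl fun S _ => by ring

theorem subsetAverage_const (D : Finset α) (a : ℝ) : subsetAverage p D (fun _ => a) = a := by
  rw [subsetAverage, ← Finset.sum_mul, Finset.sum_pow_mul_eq_add_pow]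
  simp

theorem subsetAverage_insert [DecidableEq α] {a : α} {D : Finset α} (ha : a ∉ D) (g : Finset α → ℝ) :
    subsetAverage p (insert a D) g =
      p * subsetAverage p D (fun S => g (insert a S)) + (1 - p) * subsetAverage p D g := by
  simp only [subsetAverage]
  rw [Finset.sum_powerset_insert ha, Finset.mul_sum, Finset.mul_sum, add_comm]
  congr 1
  · refine Finset.sum_congr rfl fun S hS => ?_
    have hS' : a ∉ S := fun h => ha (Finset.mem_powerset.mp hS h)
    rw [Finset.card_insert_of_notMem ha, Finset.card_insert_of_notMem hS', Nat.add_sub_add_right]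
    ring
  · refine Finset.sum_congr rfl fun S hS => ?_
    have := Finset.card_le_card (Finset.mem_powerset.mp hS)
    rw [Finset.card_insert_of_notMem ha, Nat.succ_sub this, pow_succ]
    ring

theorem subsetAverage_union [DecidableEq α] {A B : Finset α} (h : Disjoint A B) (g : Finset α → ℝ) :
    subsetAverage p (A ∪ B) g =
      subsetAverage p A fun S => subsetAverage p B fun T => g (S ∪ T) := by
  induction A using Finset.induction_on generalizing g with
  | empty => simp [subsetAverage_empty]
  | insert a A ha ih =>
    rw [Finset.disjoint_insert_left] at h
    rw [Finset.insert_union, subsetAverage_insert (by simp [ha, h.1]), subsetAverage_insert ha,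
      ih h.2, ih h.2]
    simp only [Finset.insert_union]

theorem subsetAverage_map (f : α ↪ β) (D : Finset α) (g : Finset β → ℝ) :
    subsetAverage p (D.map f) g = subsetAverage p D fun S => g (S.map f) := by
  induction D using Finset.induction_on generalizing g with
  | empty => simp [subsetAverage_empty]
  | insert a D ha ih =>
    rw [Finset.map_insert, subsetAverage_insert (by simpa using ha), subsetAverage_insert ha,
      ih, ih]
    simp only [Finset.map_insert]

theorem subsetAverage_superset [DecidableEq α] {A D : Finset α} (h : A ⊆ D) :
    subsetAverage p D (fun S => if A ⊆ S then 1 else 0) = p ^ A.card := by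
  rw [← Finset.union_sdiff_of_subset h, subsetAverage_union Finset.disjoint_sdiff]
  have : ∀ S ⊆ A, (subsetAverage p (D \ A) fun T => if A ⊆ S ∪ T then (1 : ℝ) else 0) =
      if S = A then 1 else 0 := by
    intro S hS
    rw [← subsetAverage_const (D \ A) (if S = A then (1 : ℝ) else 0)]
    refine subsetAverage_congr fun T hT => ?_
    congr 1
    refine propext ⟨fun hA => hS.antisymm fun a ha => ?_, fun hA => hA ▸ Finset.subset_union_left⟩
    rcases Finset.mem_union.mp (hA ha) with h' | h'
    · exact h'
    · exact absurd ha (Finset.mem_sdiff.mp (hT h')).2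
  rw [subsetAverage_congr this]
  simp [subsetAverage]

theorem subsetAverage_disjoint [DecidableEq α] {A D : Finset α} (h : A ⊆ D) :
    subsetAverage p D (fun S => if Disjoint A S then 1 else 0) = (1 - p) ^ A.card := by
  rw [← Finset.union_sdiff_of_subset h, subsetAverage_union Finset.disjoint_sdiff]
  have : ∀ S ⊆ A, (subsetAverage p (D \ A) fun T => if Disjoint A (S ∪ T) then (1 : ℝ) else 0) =
      if S = ∅ then 1 else 0 := by
    intro S hS
    rw [← subsetAverage_const (D \ A) (if S = ∅ then (1 : ℝ) else 0)]
    refine subsetAverage_congr fun T hT => ?_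
    congr 1
    rw [Finset.disjoint_union_right]
    have h1 : Disjoint A T := Finset.disjoint_of_subset_right hT Finset.disjoint_sdiff
    refine propext ⟨fun hA => ?_, fun hA => ⟨hA ▸ Finset.disjoint_empty_right A, h1⟩⟩
    rw [disjoint_comm] at hA
    exact Finset.disjoint_self_iff_empty S |>.mp (Finset.disjoint_of_subset_right hS hA.1)
  rw [subsetAverage_congr this]
  simp [subsetAverage]

end subsetAverage

/-- Writing the average over edge sets lets disjoint blocks of pairs be exposed one after the other
by `subsetAverage_union`. -/
theorem binomialRandom_average (n : ℕ) (p : unitInterval) (f : SimpleGraph (Fin n) → ℝ) :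
    ∑ G : SimpleGraph (Fin n), (SimpleGraph.binomialRandom (Fin n) p).real {G} * f G =
      subsetAverage p (Finset.univ.filter fun e : Sym2 (Fin n) => ¬ e.IsDiag)
        fun S => f (SimpleGraph.fromEdgeSet (S : Set (Sym2 (Fin n)))) := by
  unfold subsetAverage
  have hcard : (Finset.univ.filter fun e : Sym2 (Fin n) => ¬ e.IsDiag).card = n.choose 2 := by
    have := Sym2.card_subtype_not_diag (α := Fin n)
    rw [Fintype.card_subtype] at this
    simpa using this
  refine Finset.sum_bij' (fun G _ => G.edgeFinset)
    (fun S _ => SimpleGraph.fromEdgeSet (S : Set (Sym2 (Fin n)))) ?_ (by simp) (by simp) ?_ ?_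
  · intro G _
    rw [Finset.mem_powerset]
    intro e he
    simp only [Finset.mem_filter, Finset.mem_univ, true_and]
    exact G.not_isDiag_of_mem_edgeFinset he
  · intro S hS
    ext e
    rw [← Finset.mem_coe, SimpleGraph.coe_edgeFinset, SimpleGraph.edgeSet_fromEdgeSet]
    rw [Finset.mem_powerset] at hS
    simp only [Set.mem_sdiff, Finset.mem_coe, and_iff_left_iff_imp]
    intro he
    simpa using (Finset.mem_filter.mp (hS he)).2
  · intro G _
    rw [hcard]
    simp only [SimpleGraph.coe_edgeFinset, SimpleGraph.fromEdgeSet_edgeSet]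
    congr 1
    rw [MeasureTheory.measureReal_def, SimpleGraph.binomialRandom_singleton]
    rw [← SimpleGraph.coe_edgeFinset, Set.ncard_coe_finset]
    simp

/-- A discount for the risk of the events of probability `ε i`, `i ≥ c`. -/
theorem exists_discount {ε : ℕ → ℝ} (h0 : ∀ i, 0 ≤ ε i) (hs : Summable ε) :
    ∃ ψ : ℕ → ℝ, Monotone ψ ∧ 0 < ψ 0 ∧ (∀ c, ψ c ≤ 1) ∧
      ∀ c, ε c * ψ c ≤ ψ (c + 1) - ψ c := by
  have hs' : ∀ c, Summable fun i => ε (i + c) := fun c => (summable_nat_add_iff c).mpr hs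
  have hstep : ∀ c, ∑' i, ε (i + c) = ε c + ∑' i, ε (i + (c + 1)) := by
    intro c
    rw [(hs' c).tsum_eq_zero_add]
    simp only [zero_add]
    congr 2
    ext i
    congr 1
    ring
  -- The discount is the exponential of minus the remaining risk; the increment bound is `1 + x ≤
  -- exp x`.
  have hinc : ∀ c, ε c * Real.exp (-∑' i, ε (i + c)) ≤
      Real.exp (-∑' i, ε (i + (c + 1))) - Real.exp (-∑' i, ε (i + c)) := by
    intro c
    have : Real.exp (-∑' i, ε (i + (c + 1))) = Real.exp (ε c) * Real.exp (-∑' i, ε (i + c)) := by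
      rw [← Real.exp_add]
      congr 1
      linarith [hstep c]
    rw [this]
    have h1 := Real.add_one_le_exp (ε c)
    have h2 := Real.exp_pos (-∑' i, ε (i + c))
    nlinarith
  refine ⟨fun c => Real.exp (-∑' i, ε (i + c)), ?_, Real.exp_pos _, ?_, hinc⟩
  · refine monotone_nat_of_le_succ fun c => ?_
    have := mul_nonneg (h0 c) (Real.exp_pos (-∑' i, ε (i + c))).le
    linarith [hinc c]
  · intro c
    rw [Real.exp_le_one_iff, neg_nonpos]
    exact tsum_nonneg fun i => h0 _


/-- The exponent is `i / 2` because the watchers are split into two halves, each of which must be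
hit. -/
theorem summable_pow_half {r : ℝ} (h0 : 0 ≤ r) (h1 : r < 1) :
    Summable fun i : ℕ => r ^ (i / 2) := by
  have hg := (summable_geometric_of_lt_one h0 h1).hasSum
  have he : HasSum (fun k : ℕ => (fun i : ℕ => r ^ (i / 2)) (2 * k)) (∑' k : ℕ, r ^ k) := by
    have : ∀ k : ℕ, 2 * k / 2 = k := fun k => by omega
    simpa only [this] using hg
  have ho : HasSum (fun k : ℕ => (fun i : ℕ => r ^ (i / 2)) (2 * k + 1)) (∑' k : ℕ, r ^ k) := by
    have : ∀ k : ℕ, (2 * k + 1) / 2 = k := fun k => by omega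
    simpa only [this] using hg
  exact (HasSum.even_add_odd (f := fun i : ℕ => r ^ (i / 2)) he ho).summable

end SocialLearning
end

/-! ### Exposing the graph agent by agent -/

noncomputable section
namespace SocialLearning

section Locality

variable {n : ℕ} {G G' : SimpleGraph (Fin n)} {q : ℝ} {σ : Equiv.Perm (Fin n)}

theorem bayesAction_congr_graph (v : Fin n)
    (h : ∀ u, σ u ≤ σ v → earlierNbrs G σ u = earlierNbrs G' σ u) :
    bayesAction G q σ v = bayesAction G' q σ v := by
  have hv : ∀ s s', SameView G q σ v s s' ↔ SameView G' q σ v s s' := by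
    intro s s'
    rw [SameView, SameView, ← h v le_rfl]
    refine forall₂_congr fun u hu => ?_
    have hlt := (mem_earlierNbrs.mp hu).2
    rw [bayesAction_congr_graph u fun w hw => h w (hw.trans hlt.le)]
  funext s
  have hw : viewWeight G q σ v s = viewWeight G' q σ v s := by
    funext c
    exact condProb_congr q c fun t => by rw [hv]
  rw [bayesAction_eq, bayesAction_eq, hw]
termination_by (σ v).val
decreasing_by exact hlt

theorem reveals_congr_graph {v : Fin n}
    (h : ∀ u, σ u ≤ σ v → earlierNbrs G σ u = earlierNbrs G' σ u) (s : Fin n → Bool) :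
    Reveals G q σ v s ↔ Reveals G' q σ v s := by
  refine forall_congr' fun b => ?_
  rw [herdExcess, herdExcess, excess_congr q b fun s' => ?_]
  rw [SameView, SameView, ← h v le_rfl]
  refine forall₂_congr fun u hu => ?_
  have hlt := (mem_earlierNbrs.mp hu).2
  rw [bayesAction_congr_graph u fun w hw => h w (hw.trans hlt.le)]

theorem code_congr_graph {k : ℕ}
    (h : ∀ u, (σ u).val < k → earlierNbrs G σ u = earlierNbrs G' σ u) (s : Fin n → Bool) :
    code G q σ s k = code G' q σ s k := by
  induction k with
  | zero => rfl
  | succ k ih =>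
    rw [code, code, ih fun u hu => h u (by omega)]
    split_ifs with hk h1 h2 h2
    · rfl
    · refine absurd ((reveals_congr_graph (fun u hu => h u ?_) s).mp h1) h2
      rw [Equiv.apply_symm_apply, Fin.le_def] at hu
      exact Nat.lt_succ_of_le hu
    · refine absurd ((reveals_congr_graph (fun u hu => h u ?_) s).mpr h2) h1
      rw [Equiv.apply_symm_apply, Fin.le_def] at hu
      exact Nat.lt_succ_of_le hu
    · rfl
    · rfl

/-- Being a node is decided by the edges among agents up to `v`, so the set of nodes is adapted to
the exposure. -/
theorem mem_nodes_congr_graph {m : ℕ} {v : Fin n}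
    (h : ∀ u, σ u ≤ σ v → earlierNbrs G σ u = earlierNbrs G' σ u) :
    v ∈ nodes G q σ m ↔ v ∈ nodes G' q σ m := by
  rw [mem_nodes, mem_nodes]
  refine exists_congr fun s => ?_
  rw [reveals_congr_graph h, code_congr_graph fun u hu => h u (le_of_lt hu)]

end Locality

variable {n : ℕ} (σ : Equiv.Perm (Fin n)) (nd : SimpleGraph (Fin n) → Finset (Fin n))

/-- The agents in the first `k` positions. -/
def firstAgents (k : ℕ) : Finset (Fin n) := Finset.univ.filter fun u => (σ u).val < k

/-- The pairs of distinct agents in the first `k` positions. -/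
def firstPairs (k : ℕ) : Finset (Sym2 (Fin n)) :=
  Finset.univ.filter fun e => ¬ e.IsDiag ∧ ∀ u ∈ e, (σ u).val < k

/-- The nodes in the first `k` positions. -/
def firstNodes (k : ℕ) (G : SimpleGraph (Fin n)) : Finset (Fin n) :=
  (nd G).filter fun u => (σ u).val < k

/-- The agents in the first `k` positions that see all nodes in the first `k` positions. -/
def watchers (k : ℕ) (G : SimpleGraph (Fin n)) : Finset (Fin n) :=
  (firstAgents σ k).filter fun w => firstNodes σ nd k G ⊆ earlierNbrs G σ w

/-- The map that sends `u` to the pair of `u` and `v`. -/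
def pairWith (v : Fin n) : Fin n ↪ Sym2 (Fin n) :=
  ⟨fun u => s(u, v), fun _ _ h => Sym2.congr_left.mp h⟩

/-- The graph with edges `S` and the edges from `v` to `N`. -/
def addNbrs (S : Finset (Sym2 (Fin n))) (v : Fin n) (N : Finset (Fin n)) :
    SimpleGraph (Fin n) :=
  SimpleGraph.fromEdgeSet ((S ∪ N.map (pairWith v) : Finset (Sym2 (Fin n))) : Set (Sym2 (Fin n)))

variable {σ nd}

theorem pairWith_apply (u v : Fin n) : pairWith v u = s(u, v) := rfl

theorem mem_firstAgents {k : ℕ} {u : Fin n} : u ∈ firstAgents σ k ↔ (σ u).val < k := by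
  simp [firstAgents]

theorem mem_firstNodes {k : ℕ} {G : SimpleGraph (Fin n)} {u : Fin n} :
    u ∈ firstNodes σ nd k G ↔ u ∈ nd G ∧ (σ u).val < k := by
  simp [firstNodes]

theorem mem_watchers {k : ℕ} {G : SimpleGraph (Fin n)} {w : Fin n} :
    w ∈ watchers σ nd k G ↔ (σ w).val < k ∧ firstNodes σ nd k G ⊆ earlierNbrs G σ w := by
  simp [watchers, mem_firstAgents]

theorem firstPairs_succ (v : Fin n) :
    firstPairs σ ((σ v).val + 1) = firstPairs σ (σ v).val ∪
      (firstAgents σ (σ v).val).map (pairWith v) ∧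
    Disjoint (firstPairs σ (σ v).val)
      ((firstAgents σ (σ v).val).map (pairWith v)) := by
  have heq : ∀ u, (σ u).val = (σ v).val → u = v := fun u h => σ.injective (Fin.ext h)
  constructor
  · ext e
    induction e with
    | _ a b =>
    simp only [firstPairs, firstAgents, Finset.mem_filter, Finset.mem_univ, true_and,
      Finset.mem_union, Finset.mem_map, pairWith_apply, Sym2.mk_isDiag_iff,
      Sym2.mem_iff, forall_eq_or_imp, forall_eq]
    constructor
    · rintro ⟨hab, ha, hb⟩
      by_cases h1 : (σ a).val < (σ v).val
      · by_cases h2 : (σ b).val < (σ v).val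
        · exact Or.inl ⟨hab, h1, h2⟩
        · exact Or.inr ⟨a, h1, by rw [heq b (by omega)]⟩
      · have hav := heq a (by omega)
        by_cases h2 : (σ b).val < (σ v).val
        · exact Or.inr ⟨b, h2, by rw [hav, Sym2.eq_swap]⟩
        · exact absurd (hav.trans (heq b (by omega)).symm) hab
    · rintro (⟨hab, h1, h2⟩ | ⟨u, hu, he⟩)
      · exact ⟨hab, by omega, by omega⟩
      · rcases Sym2.eq_iff.mp he with ⟨rfl, rfl⟩ | ⟨rfl, rfl⟩
        · exact ⟨fun h => by rw [h] at hu; omega, by omega, by omega⟩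
        · exact ⟨fun h => by rw [h] at hu; omega, by omega, by omega⟩
  · rw [Finset.disjoint_left]
    intro e he he'
    obtain ⟨u, -, rfl⟩ := Finset.mem_map.mp he'
    have := (Finset.mem_filter.mp he).2.2 v (Sym2.mem_mk_right u v)
    exact lt_irrefl _ this

theorem earlierNbrs_addNbrs {S : Finset (Sym2 (Fin n))} {v : Fin n} {N : Finset (Fin n)}
    (hS : S ⊆ firstPairs σ (σ v).val) (hN : N ⊆ firstAgents σ (σ v).val) :
    earlierNbrs (addNbrs S v N) σ v = N ∧
    ∀ u, (σ u).val < (σ v).val →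
      earlierNbrs (SimpleGraph.fromEdgeSet (S : Set (Sym2 (Fin n)))) σ u =
      earlierNbrs (addNbrs S v N) σ u := by
  constructor
  · ext u
    simp only [addNbrs, mem_earlierNbrs, SimpleGraph.fromEdgeSet_adj, Finset.coe_union, Set.mem_union,
      Finset.mem_coe, Finset.mem_map, pairWith_apply]
    constructor
    · rintro ⟨⟨h | ⟨w, hw, he⟩, -⟩, -⟩
      · exact absurd ((Finset.mem_filter.mp (hS h)).2.2 v (Sym2.mem_mk_right u v)) (lt_irrefl _)
      · rwa [← Sym2.congr_left.mp he]
    · intro hu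
      have := mem_firstAgents.mp (hN hu)
      exact ⟨⟨Or.inr ⟨u, hu, rfl⟩, fun h => by rw [h] at this; omega⟩, this⟩
  · intro u huv
    ext w
    simp only [addNbrs, mem_earlierNbrs, SimpleGraph.fromEdgeSet_adj, Finset.coe_union, Set.mem_union,
      Finset.mem_coe, Finset.mem_map, pairWith_apply]
    constructor
    · rintro ⟨⟨h, h'⟩, h''⟩
      exact ⟨⟨Or.inl h, h'⟩, h''⟩
    · rintro ⟨⟨h | ⟨x, hx, he⟩, h'⟩, h''⟩
      · exact ⟨⟨h, h'⟩, h''⟩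
      · rw [Fin.lt_def] at h''
        rcases Sym2.eq_iff.mp he with ⟨-, rfl⟩ | ⟨-, rfl⟩ <;> omega

variable (σ nd) in
/-- All agents between the third one and position `k` are well connected. -/
def WellConnectedBelow (k : ℕ) (G : SimpleGraph (Fin n)) : Prop :=
  ∀ v, 2 ≤ (σ v).val → (σ v).val < k → WellConnected σ nd G v

variable (σ nd) in
/-- A lower bound for the chance that a graph whose first `k` agents are well connected stays so,
when at most `R` nodes can appear. -/
def survival (R : ℕ) (ψ : ℕ → ℝ) (k : ℕ) (G : SimpleGraph (Fin n)) : ℝ :=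
  if WellConnectedBelow σ nd k G then
    ψ 0 ^ (R - (firstNodes σ nd k G).card) * ψ (watchers σ nd k G).card
  else 0

theorem wellConnected_iff {G : SimpleGraph (Fin n)} {v : Fin n} :
    WellConnected σ nd G v ↔ firstNodes σ nd (σ v).val G ⊆ earlierNbrs G σ v ∨
      ∃ w ∈ earlierNbrs G σ v, ∃ w' ∈ earlierNbrs G σ v, w ≠ w' ∧
        firstNodes σ nd (σ v).val G ⊆ earlierNbrs G σ w ∧
        firstNodes σ nd (σ v).val G ⊆ earlierNbrs G σ w' := by
  simp only [WellConnected, Finset.subset_iff, mem_firstNodes, and_imp, Fin.lt_def]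

theorem firstNodes_congr
    (hloc : ∀ (G G' : SimpleGraph (Fin n)) (v : Fin n),
      (∀ u, σ u ≤ σ v → earlierNbrs G σ u = earlierNbrs G' σ u) → (v ∈ nd G ↔ v ∈ nd G'))
    {k : ℕ} {G G' : SimpleGraph (Fin n)}
    (h : ∀ u, (σ u).val < k → earlierNbrs G σ u = earlierNbrs G' σ u) :
    firstNodes σ nd k G = firstNodes σ nd k G' := by
  ext u
  rw [mem_firstNodes, mem_firstNodes]
  exact and_congr_left fun hu => hloc G G' u fun w hw => h w (lt_of_le_of_lt hw hu)

theorem watchers_congr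
    (hloc : ∀ (G G' : SimpleGraph (Fin n)) (v : Fin n),
      (∀ u, σ u ≤ σ v → earlierNbrs G σ u = earlierNbrs G' σ u) → (v ∈ nd G ↔ v ∈ nd G'))
    {k : ℕ} {G G' : SimpleGraph (Fin n)}
    (h : ∀ u, (σ u).val < k → earlierNbrs G σ u = earlierNbrs G' σ u) :
    watchers σ nd k G = watchers σ nd k G' := by
  ext w
  rw [mem_watchers, mem_watchers, firstNodes_congr hloc h]
  exact and_congr_right fun hw => by rw [h w hw]

theorem wellConnectedBelow_congr
    (hloc : ∀ (G G' : SimpleGraph (Fin n)) (v : Fin n),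
      (∀ u, σ u ≤ σ v → earlierNbrs G σ u = earlierNbrs G' σ u) → (v ∈ nd G ↔ v ∈ nd G'))
    {k : ℕ} {G G' : SimpleGraph (Fin n)}
    (h : ∀ u, (σ u).val < k → earlierNbrs G σ u = earlierNbrs G' σ u) :
    WellConnectedBelow σ nd k G ↔ WellConnectedBelow σ nd k G' := by
  refine forall_congr' fun v => forall_congr' fun _ => forall_congr' fun hv => ?_
  rw [wellConnected_iff, wellConnected_iff,
    firstNodes_congr hloc fun u hu => h u (hu.trans hv), h v hv]
  refine or_congr_right (exists_congr fun w => and_congr_right fun hw => exists_congr fun w' =>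
    and_congr_right fun hw' => ?_)
  have hwv : (σ w).val < (σ v).val := (mem_earlierNbrs.mp hw).2
  have hwv' : (σ w').val < (σ v).val := (mem_earlierNbrs.mp hw').2
  rw [h w (hwv.trans hv), h w' (hwv'.trans hv)]

/-- When `v` is well connected, its arrival does not lower the bound, and it raises the bound when
`v` sees all nodes. -/
theorem le_survival_succ {R : ℕ} {ψ : ℕ → ℝ} (hψ : Monotone ψ) (hψ0 : 0 < ψ 0)
    (hψ1 : ∀ c, ψ c ≤ 1) (hcard : ∀ G, (nd G).card ≤ R) {G : SimpleGraph (Fin n)} {v : Fin n}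
    (hG : WellConnectedBelow σ nd (σ v).val G) (hv : WellConnected σ nd G v) :
    ψ 0 ^ (R - (firstNodes σ nd (σ v).val G).card) * ψ ((watchers σ nd (σ v).val G).card +
      if firstNodes σ nd (σ v).val G ⊆ earlierNbrs G σ v then 1 else 0) ≤
    survival σ nd R ψ ((σ v).val + 1) G := by
  have heq : ∀ u, (σ u).val < (σ v).val + 1 ↔ u = v ∨ (σ u).val < (σ v).val := by
    intro u
    rw [Nat.lt_succ_iff_lt_or_eq, or_comm]
    exact or_congr_left ⟨fun h => σ.injective (Fin.ext h), fun h => h ▸ rfl⟩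
  have hG' : WellConnectedBelow σ nd ((σ v).val + 1) G := by
    intro u hu hu'
    rcases (heq u).mp hu' with rfl | h
    · exact hv
    · exact hG u hu h
  rw [survival, if_pos hG']
  by_cases hn : v ∈ nd G
  · have hins : firstNodes σ nd ((σ v).val + 1) G = insert v (firstNodes σ nd (σ v).val G) := by
      ext u
      rw [mem_firstNodes, heq, Finset.mem_insert, mem_firstNodes]
      constructor
      · rintro ⟨h, rfl | h'⟩
        · exact Or.inl rfl
        · exact Or.inr ⟨h, h'⟩
      · rintro (rfl | ⟨h, h'⟩)
        · exact ⟨hn, Or.inl rfl⟩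
        · exact ⟨h, Or.inr h'⟩
    have hc : (firstNodes σ nd ((σ v).val + 1) G).card =
        (firstNodes σ nd (σ v).val G).card + 1 := by
      rw [hins, Finset.card_insert_of_notMem]
      rw [mem_firstNodes]
      exact fun h => lt_irrefl _ h.2
    have hR : (firstNodes σ nd ((σ v).val + 1) G).card ≤ R :=
      (Finset.card_le_card (Finset.filter_subset _ _)).trans (hcard G)
    rw [hc] at hR ⊢
    obtain ⟨j, hj⟩ := Nat.exists_eq_add_of_le hR
    have e1 : R - (firstNodes σ nd (σ v).val G).card = j + 1 := by omega
    have e2 : R - ((firstNodes σ nd (σ v).val G).card + 1) = j := by omega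
    -- A new node may leave no watcher at all; the factor `ψ 0` reserved for it pays for that loss.
    rw [e1, e2, pow_succ, mul_assoc]
    refine mul_le_mul_of_nonneg_left ?_ (pow_nonneg hψ0.le j)
    exact (mul_le_of_le_one_right hψ0.le (hψ1 _)).trans (hψ (Nat.zero_le _))
  · have hsame : firstNodes σ nd ((σ v).val + 1) G = firstNodes σ nd (σ v).val G := by
      ext u
      rw [mem_firstNodes, heq, mem_firstNodes]
      refine and_congr_right fun h => or_iff_right ?_
      rintro rfl
      exact hn h
    rw [hsame]
    refine mul_le_mul_of_nonneg_left (hψ ?_) (pow_nonneg hψ0.le _)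
    -- Without a new node all watchers remain, and `v` joins them if it sees every node.
    have hsub : watchers σ nd (σ v).val G ⊆ watchers σ nd ((σ v).val + 1) G := by
      intro w hw
      rw [mem_watchers] at hw ⊢
      rw [hsame]
      exact ⟨by omega, hw.2⟩
    split_ifs with h
    · rw [← Finset.card_insert_of_notMem (s := watchers σ nd (σ v).val G) (a := v)]
      · refine Finset.card_le_card (Finset.insert_subset ?_ hsub)
        rw [mem_watchers, hsame]
        exact ⟨by omega, h⟩
      · rw [mem_watchers]
        exact fun h => lt_irrefl _ h.1
    · exact Finset.card_le_card hsub

theorem survival_nonneg {R : ℕ} {ψ : ℕ → ℝ} (hψ : Monotone ψ) (hψ0 : 0 < ψ 0) (k : ℕ)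
    (G : SimpleGraph (Fin n)) : 0 ≤ survival σ nd R ψ k G := by
  rw [survival]
  split_ifs
  · exact mul_nonneg (pow_nonneg hψ0.le _) (hψ0.le.trans (hψ (Nat.zero_le _)))
  · exact le_rfl

/-- The bound does not decrease on average when the neighbours of one more agent are drawn. -/
theorem survival_le_average {R : ℕ} {ψ : ℕ → ℝ} (hψ : Monotone ψ) (hψ0 : 0 < ψ 0)
    (hψ1 : ∀ c, ψ c ≤ 1) (hcard : ∀ G, (nd G).card ≤ R)
    (hloc : ∀ (G G' : SimpleGraph (Fin n)) (v : Fin n),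
      (∀ u, σ u ≤ σ v → earlierNbrs G σ u = earlierNbrs G' σ u) → (v ∈ nd G ↔ v ∈ nd G'))
    {δ p : ℝ} (hδ : 0 < δ) (hδ1 : δ ≤ 1) (hp : δ ≤ p) (hp1 : p ≤ 1)
    (hinc : ∀ c, 2 * (1 - δ) ^ (c / 2) * ψ c ≤ δ ^ R * (ψ (c + 1) - ψ c))
    {S : Finset (Sym2 (Fin n))} (v : Fin n) (hS : S ⊆ firstPairs σ (σ v).val) :
    survival σ nd R ψ (σ v).val (SimpleGraph.fromEdgeSet (S : Set (Sym2 (Fin n)))) ≤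
      subsetAverage p (firstAgents σ (σ v).val) fun N =>
        survival σ nd R ψ ((σ v).val + 1) (addNbrs S v N) := by
  have hp0 : 0 ≤ p := hδ.le.trans hp
  set G := SimpleGraph.fromEdgeSet (S : Set (Sym2 (Fin n))) with hGdef
  by_cases hG : WellConnectedBelow σ nd (σ v).val G
  swap
  · rw [survival, if_neg hG, ← subsetAverage_const (p := p) (firstAgents σ (σ v).val) (0 : ℝ)]
    exact subsetAverage_mono hp0 hp1 fun N _ => survival_nonneg hψ hψ0 _ _
  rw [survival, if_pos hG]
  set L := firstNodes σ nd (σ v).val G with hL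
  set W := watchers σ nd (σ v).val G with hW
  set K := ψ 0 ^ (R - L.card) with hK
  have hK0 : 0 ≤ K := pow_nonneg hψ0.le _
  -- Hitting both `C` and `W \ C` provides two distinct watchers.
  obtain ⟨C, hCW, hC⟩ := Finset.exists_subset_card_eq (Nat.div_le_self W.card 2)
  have hLsub : L ⊆ firstAgents σ (σ v).val := fun u hu =>
    mem_firstAgents.mpr (mem_firstNodes.mp hu).2
  have hWsub : W ⊆ firstAgents σ (σ v).val := Finset.filter_subset _ _
  have hψc : 0 ≤ ψ W.card := hψ0.le.trans (hψ (Nat.zero_le _))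
  have hψi : 0 ≤ ψ (W.card + 1) - ψ W.card := sub_nonneg.mpr (hψ (Nat.le_succ _))
  -- A pointwise bound linear in three indicators: gain when `v` sees all nodes, loss for each half
  -- missed. Its average is explicit, and `hinc` balances gain against loss.
  have hlow : ∀ N ⊆ firstAgents σ (σ v).val,
      K * ((ψ (W.card + 1) - ψ W.card) * (if L ⊆ N then 1 else 0) + (ψ W.card +
        (-ψ W.card * (if Disjoint C N then 1 else 0) +
          -ψ W.card * (if Disjoint (W \ C) N then 1 else 0)))) ≤
      survival σ nd R ψ ((σ v).val + 1) (addNbrs S v N) := by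
    intro N hN
    obtain ⟨hv, hlt⟩ := earlierNbrs_addNbrs hS hN
    have eL := firstNodes_congr hloc hlt
    have eW := watchers_congr hloc hlt
    have hG' := (wellConnectedBelow_congr hloc hlt).mp hG
    rw [← hGdef] at eL eW hlt
    rw [← hL] at eL
    rw [← hW] at eW
    have hstep : WellConnected σ nd (addNbrs S v N) v →
        K * ψ (W.card + if L ⊆ N then 1 else 0) ≤
          survival σ nd R ψ ((σ v).val + 1) (addNbrs S v N) := by
      intro hwc
      have := le_survival_succ hψ hψ0 hψ1 hcard hG' hwc
      rwa [← eL, ← eW, hv] at this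
    by_cases hLN : L ⊆ N
    · have hwc : WellConnected σ nd (addNbrs S v N) v := by
        rw [wellConnected_iff, ← eL, hv]
        exact Or.inl hLN
      refine le_trans (mul_le_mul_of_nonneg_left ?_ hK0) (hstep hwc)
      rw [if_pos hLN, if_pos hLN]
      split_ifs <;> linarith
    · rw [if_neg hLN] at hstep ⊢
      by_cases hm : ¬ Disjoint C N ∧ ¬ Disjoint (W \ C) N
      · rw [if_neg hm.1, if_neg hm.2]
        obtain ⟨w, hw, hwN⟩ := Finset.not_disjoint_iff.mp hm.1
        obtain ⟨w', hw', hwN'⟩ := Finset.not_disjoint_iff.mp hm.2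
        have hsees : ∀ w ∈ W, L ⊆ earlierNbrs (addNbrs S v N) σ w := by
          intro w hw
          have := mem_watchers.mp hw
          rw [← hlt w this.1]
          exact this.2
        have hwc : WellConnected σ nd (addNbrs S v N) v := by
          rw [wellConnected_iff, ← eL, hv]
          refine Or.inr ⟨w, hwN, w', hwN', ?_, hsees w (hCW hw),
            hsees w' (Finset.mem_sdiff.mp hw').1⟩
          rintro rfl
          exact (Finset.mem_sdiff.mp hw').2 hw
        refine le_trans (mul_le_mul_of_nonneg_left ?_ hK0) (hstep hwc)
        simp
      · refine le_trans (mul_nonpos_of_nonneg_of_nonpos hK0 ?_) (survival_nonneg hψ hψ0 _ _)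
        rw [not_and_or, not_not, not_not] at hm
        rcases hm with h | h <;> rw [if_pos h] <;> split_ifs <;> linarith
  refine le_trans ?_ (subsetAverage_mono hp0 hp1 hlow)
  rw [subsetAverage_const_mul, subsetAverage_add, subsetAverage_const_mul, subsetAverage_add,
    subsetAverage_const, subsetAverage_add, subsetAverage_const_mul, subsetAverage_const_mul,
    subsetAverage_superset hLsub, subsetAverage_disjoint (hCW.trans hWsub),
    subsetAverage_disjoint (Finset.sdiff_subset.trans hWsub)]
  refine mul_le_mul_of_nonneg_left ?_ hK0
  have h1 : δ ^ R ≤ p ^ L.card := by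
    have hLR : L.card ≤ R := (Finset.card_le_card (Finset.filter_subset _ _)).trans (hcard G)
    exact (pow_le_pow_of_le_one hδ.le hδ1 hLR).trans (pow_le_pow_left₀ hδ.le hp _)
  have hC2 : W.card / 2 ≤ (W \ C).card := by
    rw [Finset.card_sdiff_of_subset hCW, hC]
    omega
  have h2 : (1 - p) ^ C.card ≤ (1 - δ) ^ (W.card / 2) := by
    rw [hC]
    exact pow_le_pow_left₀ (by linarith) (by linarith) _
  have h3 : (1 - p) ^ (W \ C).card ≤ (1 - δ) ^ (W.card / 2) :=
    (pow_le_pow_left₀ (by linarith) (by linarith) _).trans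
      (pow_le_pow_of_le_one (by linarith) (by linarith) hC2)
  have h4 := hinc W.card
  have h5 := mul_le_mul_of_nonneg_left h1 hψi
  have h6 := mul_le_mul_of_nonneg_left h2 hψc
  have h7 := mul_le_mul_of_nonneg_left h3 hψc
  linarith

theorem survival_zero_le_average {R : ℕ} {ψ : ℕ → ℝ} (hψ : Monotone ψ) (hψ0 : 0 < ψ 0)
    (hψ1 : ∀ c, ψ c ≤ 1) (hcard : ∀ G, (nd G).card ≤ R)
    (hloc : ∀ (G G' : SimpleGraph (Fin n)) (v : Fin n),
      (∀ u, σ u ≤ σ v → earlierNbrs G σ u = earlierNbrs G' σ u) → (v ∈ nd G ↔ v ∈ nd G'))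
    {δ p : ℝ} (hδ : 0 < δ) (hδ1 : δ ≤ 1) (hp : δ ≤ p) (hp1 : p ≤ 1)
    (hinc : ∀ c, 2 * (1 - δ) ^ (c / 2) * ψ c ≤ δ ^ R * (ψ (c + 1) - ψ c)) {k : ℕ} (hk : k ≤ n) :
    ψ 0 ^ R * ψ 0 ≤ subsetAverage p (firstPairs σ k) fun S =>
      survival σ nd R ψ k (SimpleGraph.fromEdgeSet (S : Set (Sym2 (Fin n)))) := by
  induction k with
  | zero =>
    have h0 : firstPairs σ 0 = ∅ := by
      refine Finset.eq_empty_of_forall_notMem fun e he => ?_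
      induction e with
      | _ a b =>
      exact Nat.not_lt_zero _ ((Finset.mem_filter.mp he).2.2 a (Sym2.mem_mk_left a b))
    have hwc : WellConnectedBelow σ nd 0 (SimpleGraph.fromEdgeSet ((∅ : Finset (Sym2 (Fin n))) :
        Set (Sym2 (Fin n)))) := fun v _ h => absurd h (Nat.not_lt_zero _)
    rw [h0, subsetAverage_empty, survival, if_pos hwc]
    have h1 : firstNodes σ nd 0 (SimpleGraph.fromEdgeSet ((∅ : Finset (Sym2 (Fin n))) :
        Set (Sym2 (Fin n)))) = ∅ :=
      Finset.eq_empty_of_forall_notMem fun u hu => Nat.not_lt_zero _ (mem_firstNodes.mp hu).2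
    rw [h1, Finset.card_empty, Nat.sub_zero]
    exact mul_le_mul_of_nonneg_left (hψ (Nat.zero_le _)) (pow_nonneg hψ0.le _)
  | succ k ih =>
    refine (ih (by omega)).trans ?_
    obtain ⟨v, hv⟩ : ∃ v, (σ v).val = k := ⟨σ.symm ⟨k, hk⟩, by simp⟩
    subst hv
    obtain ⟨hu, hd⟩ := firstPairs_succ (σ := σ) v
    rw [hu, subsetAverage_union hd]
    refine subsetAverage_mono (hδ.le.trans hp) hp1 fun S hS => ?_
    rw [subsetAverage_map]
    exact survival_le_average hψ hψ0 hψ1 hcard hloc hδ hδ1 hp hp1 hinc v hS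

/-- If at most `R` nodes can appear, and their appearance at `v` depends only on the graph on the
agents up to `v`, then the random graph is well connected with probability bounded below. -/
theorem exists_wellConnected_bound (R : ℕ) {δ : ℝ} (hδ : 0 < δ) (hδ1 : δ ≤ 1) :
    ∃ c : ℝ, 0 < c ∧ ∀ (n : ℕ) (p : unitInterval) (σ : Equiv.Perm (Fin n))
      (nd : SimpleGraph (Fin n) → Finset (Fin n)), δ ≤ (p : ℝ) → (∀ G, (nd G).card ≤ R) →
      (∀ (G G' : SimpleGraph (Fin n)) (v : Fin n),
        (∀ u, σ u ≤ σ v → earlierNbrs G σ u = earlierNbrs G' σ u) → (v ∈ nd G ↔ v ∈ nd G')) →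
      c ≤ ∑ G : SimpleGraph (Fin n), (SimpleGraph.binomialRandom (Fin n) p).real {G} *
        if ∀ v, 2 ≤ (σ v).val → WellConnected σ nd G v then 1 else 0 := by
  have hη : 0 < δ ^ R := pow_pos hδ R
  obtain ⟨ψ, hψ, hψ0, hψ1, hinc⟩ := exists_discount
    -- The chance of missing a half of `c` watchers, relative to the chance `δ ^ R` of gaining a
    -- watcher.
    (ε := fun c => 2 / δ ^ R * (1 - δ) ^ (c / 2))
    (fun i => mul_nonneg (by positivity) (pow_nonneg (by linarith) _))
    ((summable_pow_half (by linarith) (by linarith)).mul_left _)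
  refine ⟨ψ 0 ^ R * ψ 0, by positivity, fun n p σ nd hp hcard hloc => ?_⟩
  have hinc' : ∀ c, 2 * (1 - δ) ^ (c / 2) * ψ c ≤ δ ^ R * (ψ (c + 1) - ψ c) := by
    intro c
    have := mul_le_mul_of_nonneg_left (hinc c) hη.le
    refine le_trans (le_of_eq ?_) this
    field_simp
  refine (survival_zero_le_average (σ := σ) hψ hψ0 hψ1 hcard hloc hδ hδ1 hp p.2.2 hinc'
    le_rfl).trans ?_
  rw [binomialRandom_average]
  have hD : firstPairs σ n = Finset.univ.filter fun e : Sym2 (Fin n) => ¬ e.IsDiag := by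
    ext e
    simp [firstPairs]
  rw [hD]
  refine subsetAverage_mono p.2.1 p.2.2 fun S _ => ?_
  rw [survival]
  split_ifs with h1 h2 h2
  · exact mul_le_one₀ (pow_le_one₀ hψ0.le (hψ1 0)) (hψ0.le.trans (hψ (Nat.zero_le _))) (hψ1 _)
  · exact absurd (fun v hv => h1 v hv (σ v).isLt) h2
  · exact zero_le_one
  · exact le_rfl

end SocialLearning
end

/-! ### Majority agents, averages over graph and order, and the conclusion -/

noncomputable section
namespace SocialLearning

variable {n : ℕ} {G : SimpleGraph (Fin n)} {q : ℝ} {σ : Equiv.Perm (Fin n)}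

theorem majorityAction_eq_of_unanimous {v : Fin n} {s : Fin n → Bool} {b : Bool}
    (h : ∀ u ∈ earlierNbrs G σ v, majorityAction G σ u s = b)
    (h2 : s v = b ∨ 2 ≤ (earlierNbrs G σ v).card) : majorityAction G σ v s = b := by
  have hb : (∑ u : {u // u ∈ earlierNbrs G σ v}, if majorityAction G σ u.1 s = b then 1 else 0) =
      (earlierNbrs G σ v).card := by
    rw [Finset.sum_congr rfl fun u _ => if_pos (h u.1 u.2)]
    simp
  have hnb : (∑ u : {u // u ∈ earlierNbrs G σ v}, if majorityAction G σ u.1 s = !b then 1 else 0) =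
      0 := by
    refine Finset.sum_eq_zero fun u _ => if_neg ?_
    rw [h u.1 u.2]
    simp
  rw [majorityAction]
  clear h
  cases b <;> simp only [Bool.not_true, Bool.not_false] at hnb <;> simp only [hb, hnb] <;>
    cases hs : s v <;> simp [hs] at h2 ⊢ <;> grind

theorem majorityAction_eq_of_twoEarlierNbrs (hG : TwoEarlierNbrs G σ) {b : Bool}
    {s : Fin n → Bool} (hs : ∀ v, (σ v).val < 2 → s v = b) (v : Fin n) :
    majorityAction G σ v s = b := by
  refine majorityAction_eq_of_unanimous (fun u hu => ?_) ?_
  · have hlt := (mem_earlierNbrs.mp hu).2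
    exact majorityAction_eq_of_twoEarlierNbrs hG hs u
  · by_cases h : (σ v).val < 2
    · exact Or.inl (hs v h)
    · exact Or.inr (hG v (not_lt.mp h))
termination_by (σ v).val
decreasing_by exact hlt

/-- Either `v` sees the first two agents, which are nodes because `2 ≤ 2 * m`, or it has two
distinct neighbours by definition. -/
theorem twoEarlierNbrs_of_wellConnected (hq : 1 / 2 < q) {m : ℕ} (hm1 : 1 ≤ m)
    (hG : ∀ v, 2 ≤ (σ v).val → WellConnected σ (fun G => nodes G q σ (2 * m)) G v) :
    TwoEarlierNbrs G σ := by
  intro v hv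
  have hn : 2 < n := by have := (σ v).isLt; omega
  rw [Nat.succ_le_iff, Finset.one_lt_card]
  rcases hG v hv with h | ⟨w, hw, w', hw', hne, -⟩
  · refine ⟨σ.symm ⟨0, by omega⟩, h _ (mem_nodes_of_pos_lt_two hq (by omega) (by simp)) ?_,
      σ.symm ⟨1, by omega⟩, h _ (mem_nodes_of_pos_lt_two hq (by omega) (by simp)) ?_, ?_⟩
    · rw [Equiv.apply_symm_apply, Fin.lt_def]
      exact lt_of_lt_of_le two_pos hv
    · rw [Equiv.apply_symm_apply, Fin.lt_def]
      exact lt_of_lt_of_le one_lt_two hv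
    · simp
  · exact ⟨w, hw, w', hw', hne⟩

theorem action_eq_of_wellConnected (M : Model) (hq : 1 / 2 < q) (hq1 : q < 1) {m : ℕ}
    (hm1 : 1 ≤ m) (hm : (4 * (q * (1 - q))) ^ m < (1 - q) * (2 * q - 1))
    (hG : ∀ v, 2 ≤ (σ v).val → WellConnected σ (fun G => nodes G q σ (2 * m)) G v)
    {b : Bool} {s : Fin n → Bool} (hs : ∀ v, (σ v).val < 2 → s v = b) (v : Fin n) :
    action M G q σ v s = b := by
  cases M with
  | bayesian => exact bayesAction_eq_of_wellConnected hq hq1 hm1 hm hG hs v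
  | majority =>
    exact majorityAction_eq_of_twoEarlierNbrs (twoEarlierNbrs_of_wellConnected hq hm1 hG) hs v

theorem prob_nonneg (h0 : 0 ≤ q) (h1 : q ≤ 1) (E : Bool → (Fin n → Bool) → Prop) :
    0 ≤ prob q E := by
  rw [prob_eq_condProb]
  exact Finset.sum_nonneg fun θ _ => mul_nonneg (by norm_num) (condProb_nonneg h0 h1 θ _)

theorem prob_add_le_one (h0 : 0 ≤ q) (h1 : q ≤ 1) {E F : Bool → (Fin n → Bool) → Prop}
    (h : ∀ θ s, E θ s → ¬ F θ s) : prob q E + prob q F ≤ 1 := by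
  have key : ∀ θ, condProb q θ (E θ) + condProb q θ (F θ) ≤ 1 := fun θ => by
    rw [← condProb_or q θ (h θ), ← condProb_true (n := n) q θ]
    exact condProb_mono h0 h1 θ fun _ _ => trivial
  rw [prob_eq_condProb, prob_eq_condProb, Fintype.sum_bool, Fintype.sum_bool]
  linarith [key true, key false]

theorem le_prob_herd (M : Model) (hq : 1 / 2 < q) (hq1 : q < 1) {m : ℕ}
    (hm1 : 1 ≤ m) (hm : (4 * (q * (1 - q))) ^ m < (1 - q) * (2 * q - 1)) (hn : 2 ≤ n)
    (hG : ∀ v, 2 ≤ (σ v).val → WellConnected σ (fun G => nodes G q σ (2 * m)) G v) :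
    (1 - q) ^ 2 ≤ prob q fun θ s => (∀ v, (σ v).val < 2 → s v ≠ θ) ∧ TwoEarlierNbrs G σ ∧
      ∀ v, action M G q σ v s ≠ θ := by
  set x := σ.symm ⟨0, by omega⟩ with hx
  set y := σ.symm ⟨1, by omega⟩ with hy
  have hsx : (σ x).val = 0 := by simp [hx]
  have hsy : (σ y).val = 1 := by simp [hy]
  have hxy : x ≠ y := fun h => by rw [h] at hsx; omega
  have key : ∀ θ, (1 - q) ^ 2 ≤ condProb q θ fun s => (∀ v, (σ v).val < 2 → s v ≠ θ) ∧
      TwoEarlierNbrs G σ ∧ ∀ v, action M G q σ v s ≠ θ := by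
    intro θ
    have h2 := condProb_two_signals q θ (!θ) hxy
    have hb : bitProb q θ (!θ) = 1 - q := by simp [bitProb]
    rw [hb, ← sq] at h2
    rw [← h2]
    refine condProb_mono (by linarith) hq1.le θ fun s hs => ?_
    have hfirst : ∀ v, (σ v).val < 2 → s v = !θ := by
      intro v hv
      rcases Nat.lt_succ_iff_lt_or_eq.mp hv with h | h
      · rw [show v = x from σ.injective (Fin.ext (by omega)), hs.1]
      · rw [show v = y from σ.injective (Fin.ext (by omega)), hs.2]
    refine ⟨fun v hv => by simp [hfirst v hv], twoEarlierNbrs_of_wellConnected hq hm1 hG,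
      fun v => ?_⟩
    rw [action_eq_of_wellConnected M hq hq1 hm1 hm hG hfirst v]
    simp
  rw [prob_eq_condProb, Fintype.sum_bool]
  linarith [key true, key false]

theorem erAverage_eq (n : ℕ) (p : unitInterval)
    (f : SimpleGraph (Fin n) → Equiv.Perm (Fin n) → ℝ) :
    erAverage n p f = (1 / (n.factorial : ℝ)) * ∑ σ : Equiv.Perm (Fin n),
      ∑ G : SimpleGraph (Fin n), (SimpleGraph.binomialRandom (Fin n) p).real {G} * f G σ := by
  rw [erAverage, Finset.sum_comm, Finset.mul_sum]
  refine Finset.sum_congr rfl fun G _ => ?_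
  rw [← Finset.mul_sum]
  ring

theorem le_erAverage {n : ℕ} {p : unitInterval} {a : ℝ}
    {f : SimpleGraph (Fin n) → Equiv.Perm (Fin n) → ℝ}
    (h : ∀ σ, a ≤ ∑ G : SimpleGraph (Fin n),
      (SimpleGraph.binomialRandom (Fin n) p).real {G} * f G σ) : a ≤ erAverage n p f := by
  have hf : (0 : ℝ) < n.factorial := by exact_mod_cast n.factorial_pos
  rw [erAverage_eq, one_div, inv_mul_eq_div, le_div_iff₀ hf]
  calc a * n.factorial = ∑ _σ : Equiv.Perm (Fin n), a := by
        rw [Finset.sum_const, Finset.card_univ, Fintype.card_perm, Fintype.card_fin, nsmul_eq_mul,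
          mul_comm]
    _ ≤ _ := Finset.sum_le_sum fun σ _ => h σ

theorem erAverage_const (n : ℕ) (p : unitInterval) (a : ℝ) :
    erAverage n p (fun _ _ => a) = a := by
  have hf : (n.factorial : ℝ) ≠ 0 := by exact_mod_cast n.factorial_ne_zero
  have h : ∀ _ : Equiv.Perm (Fin n), ∑ G : SimpleGraph (Fin n),
      (SimpleGraph.binomialRandom (Fin n) p).real {G} * a = a := fun _ => by
    rw [binomialRandom_average n p (fun _ => a), subsetAverage_const]
  rw [erAverage_eq, Finset.sum_congr rfl fun σ _ => h σ, Finset.sum_const, Finset.card_univ,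
    Fintype.card_perm, Fintype.card_fin, nsmul_eq_mul]
  field_simp

theorem erAverage_mono {n : ℕ} {p : unitInterval}
    {f g : SimpleGraph (Fin n) → Equiv.Perm (Fin n) → ℝ} (h : ∀ G σ, f G σ ≤ g G σ) :
    erAverage n p f ≤ erAverage n p g := by
  refine Finset.sum_le_sum fun G _ => mul_le_mul_of_nonneg_left ?_ MeasureTheory.measureReal_nonneg
  exact mul_le_mul_of_nonneg_left (Finset.sum_le_sum fun σ _ => h G σ) (by positivity)

theorem erAverage_add (n : ℕ) (p : unitInterval)
    (f g : SimpleGraph (Fin n) → Equiv.Perm (Fin n) → ℝ) :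
    erAverage n p (fun G σ => f G σ + g G σ) = erAverage n p f + erAverage n p g := by
  simp only [erAverage, Finset.sum_add_distrib, mul_add]

/-- A herd makes each single agent wrong, so every `agentQuality` is at most one minus its
probability. -/
theorem networkQuality_add_prob_herd_le (M : Model) (h0 : 0 ≤ q) (h1 : q ≤ 1) (hn : 1 ≤ n) :
    networkQuality M G q σ + (prob q fun θ s => (∀ v, (σ v).val < 2 → s v ≠ θ) ∧
      TwoEarlierNbrs G σ ∧ ∀ v, action M G q σ v s ≠ θ) ≤ 1 := by
  set P := prob q fun θ s => (∀ v, (σ v).val < 2 → s v ≠ θ) ∧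
      TwoEarlierNbrs G σ ∧ ∀ v, action M G q σ v s ≠ θ with hP
  have hv : ∀ v, agentQuality M G q σ v ≤ 1 - P := fun v => by
    have := prob_add_le_one h0 h1 (E := fun θ s => action M G q σ v s = θ)
      (F := fun θ s => (∀ v, (σ v).val < 2 → s v ≠ θ) ∧
        TwoEarlierNbrs G σ ∧ ∀ v, action M G q σ v s ≠ θ) fun θ s h h' => h'.2.2 v h
    rw [agentQuality]
    linarith
  have hn' : (0 : ℝ) < n := by exact_mod_cast hn
  have hsum : ∑ v, agentQuality M G q σ v ≤ n * (1 - P) := by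
    refine (Finset.sum_le_sum fun v _ => hv v).trans (le_of_eq ?_)
    rw [Finset.sum_const, Finset.card_univ, Fintype.card_fin, nsmul_eq_mul]
  have : networkQuality M G q σ ≤ 1 - P := by
    rw [networkQuality, one_div, inv_mul_eq_div, div_le_iff₀ hn']
    linarith
  linarith

theorem exists_herdingProb_bound (M : Model) (hq : 1 / 2 < q) (hq1 : q < 1) {δ : ℝ} (hδ : 0 < δ)
    (hδ1 : δ ≤ 1) : ∃ c : ℝ, 0 < c ∧ ∀ (n : ℕ) (p : unitInterval), 2 ≤ n → δ ≤ (p : ℝ) →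
      c ≤ herdingProb M q n p := by
  have hr0 : 0 ≤ 4 * (q * (1 - q)) := by nlinarith
  have hr1 : 4 * (q * (1 - q)) < 1 := by nlinarith
  obtain ⟨m, hm⟩ := exists_pow_lt_of_lt_one
    (mul_pos (sub_pos.mpr hq1) (by linarith : 0 < 2 * q - 1)) hr1
  -- The exponent is raised to `m + 1` so that it is at least `1`, which makes the first two agents
  -- nodes.
  have hm' : (4 * (q * (1 - q))) ^ (m + 1) < (1 - q) * (2 * q - 1) :=
    (pow_le_pow_of_le_one hr0 hr1.le (Nat.le_succ m)).trans_lt hm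
  obtain ⟨c, hc, H⟩ := exists_wellConnected_bound
    (List.finite_length_lt Bool (2 * (m + 1))).toFinset.card hδ hδ1
  have hq2 : 0 < (1 - q) ^ 2 := pow_pos (by linarith) 2
  refine ⟨(1 - q) ^ 2 * c, mul_pos hq2 hc, fun n p hn hp => le_erAverage fun σ => ?_⟩
  refine (mul_le_mul_of_nonneg_left (H n p σ (fun G => nodes G q σ (2 * (m + 1))) hp
    (fun G => card_nodes_le hq hq1 _) fun G G' v h => mem_nodes_congr_graph h) hq2.le).trans ?_
  rw [Finset.mul_sum]
  refine Finset.sum_le_sum fun G _ => ?_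
  rw [mul_left_comm]
  refine mul_le_mul_of_nonneg_left ?_ MeasureTheory.measureReal_nonneg
  split_ifs with h
  · rw [mul_one]
    exact le_prob_herd M hq hq1 (Nat.succ_le_succ (Nat.zero_le m)) hm' hn h
  · rw [mul_zero]
    exact prob_nonneg (by linarith) hq1.le _

end SocialLearning
end

theorem mainTheorem11 (q : ℝ) (hq : 1 / 2 < q) (hq1 : q < 1) (p : ℕ → unitInterval)
    (hp : (fun n => (p n : ℝ)) =Θ[Filter.atTop] fun _ => (1 : ℝ)) (M : SocialLearning.Model) :
    (∃ c : ℝ, 0 < c ∧ ∀ᶠ n in Filter.atTop, c ≤ SocialLearning.herdingProb M q n (p n)) ∧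
      ¬ SocialLearning.AchievesRandomTruthLearning M q p := by
  -- This half of `Θ` is the lower bound: eventually `1 ≤ C * p n`.
  obtain ⟨C, hC, hpC⟩ := hp.2.exists_pos
  obtain ⟨c, hc, H⟩ := SocialLearning.exists_herdingProb_bound M hq hq1
    (δ := min C⁻¹ 1) (by positivity) (min_le_right _ _)
  have hev : ∀ᶠ n in Filter.atTop, c ≤ SocialLearning.herdingProb M q n (p n) := by
    filter_upwards [hpC.bound, Filter.eventually_ge_atTop 2] with n hn hn2
    refine H n (p n) hn2 ((min_le_left _ _).trans ?_)
    rw [norm_one, Real.norm_of_nonneg (p n).2.1] at hn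
    rwa [inv_le_iff_one_le_mul₀' hC]
  refine ⟨⟨c, hc, hev⟩, fun hlim => ?_⟩
  have hle : ∀ᶠ n in Filter.atTop,
      (SocialLearning.erAverage n (p n) fun G σ => SocialLearning.networkQuality M G q σ) ≤
        1 - c := by
    filter_upwards [hev, Filter.eventually_ge_atTop 1] with n hn hn1
    have := SocialLearning.erAverage_mono (n := n) (p := p n) (g := fun _ _ => (1 : ℝ)) fun G σ =>
      SocialLearning.networkQuality_add_prob_herd_le (G := G) (q := q) (σ := σ) M (by linarith)
        hq1.le hn1
    rw [SocialLearning.erAverage_add, SocialLearning.erAverage_const] at this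
    unfold SocialLearning.herdingProb at hn
    linarith
  have := le_of_tendsto hlim hle
  linarith
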